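/- Let $p$ be an odd prime, $s$ a positive integer, and $s_1,s_2$ positive divisors of $s$. Write $\mathrm{Tr}_a^b$ for the trace from $\mathbb{F}_{p^b}$ to $\mathbb{F}_{p^a}$, and let $$D=\{(x,y)\in\mathbb{F}_{p^s}^2:\ \mathrm{Tr}_{s_1}^s(x^2+y^2)=0\},\qquad \mathcal{C}_D=\{(\mathrm{Tr}_{s_2}^s(ax+by))_{(x,y)\in D}+c\mathbf{1}:\ a,b\in\mathbb{F}_{p^s},\ c\in\mathbb{F}_{p^{s_2}}\},$$ a linear code over $\mathbb{F}_{p^{s_2}}$ ($\mathbf 1$ is the all-one vector). Assume that it is not the case that both $s_1=s$ and $p^s\equiv 3 \pmod 4$ (in that case $D=\{(0,0)\}$). For $t\ge 1$ put $\mathcal{G}_t=(-1)^{t-1}(\sqrt{-1})^{(\frac{p-1}{2})^2t}\sqrt{p^t}$, and let $\mathcal{G}=\mathcal{G}_s$, $\mathcal{G}'=\mathcal{G}_{s_1}$, $\mathcal{G}''=\mathcal{G}_{s_2}$. Let $\eta',\eta''$ be the quadratic characters of $\mathbb{F}_{p^{s_1}},\mathbb{F}_{p^{s_2}}$. Put $$n=\frac{p^{2s}+(p^{s_1}-1)\mathcal{G}^2}{p^{s_1}},\quad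 m=\frac{p^{2s}+(p^{s_2}-1)\mathcal{G}^2}{p^{s_2}},\quad w=\frac{p^{2s}(p^{s_2}-1)}{p^{s_1+s_2}}.$$ Let $A_j$ be the number of codewords of $\mathcal{C}_D$ of Hamming weight $j$. In the lists below, $v:\,f$ stands for a weight $v$ with frequency $f$; for each $j\ge 0$, $A_j$ is the sum of the frequencies of all entries whose weight equals $j$ (so $A_j=0$ if there is none). (i) If $s_2\mid s_1$, then $\mathcal{C}_D$ has length $n$, dimension $\frac{2s}{s_2}+1$ and the weight distribution - $0:\ 1$ - $n:\ p^{s_2}-1$ - $w:\ n-1$ - $w+\frac{(p^{s_1}-1)\mathcal{G}^2}{p^{s_1}}:\ (p^{s_2}-1)(n-1)$ - $w+\frac{(p^{s_1+s_2}-p^{s_1})\mathcal{G}^2}{p^{s_1+s_2}}:\ \frac{(p^{s_1}-1)(p^{2s}-\mathcal{G}^2)}{p^{s_1}}$ - $w+\frac{(p^{s_1+s_2}-p^{s_1}-p^{s_2})\mathcal{G}^2}{p^{s_1+s_2}}:\ \frac{(p^{s_2}-1)(p^{s_1}-1)(p^{2s}-\mathcal{G}^2)}{p^{s_1}}$ Moreover,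 if $s\ge 2s_1$, then $\mathcal{C}_D$ is self-orthogonal (contained in its dual for the standard inner product). (ii) If $s_1\mid s_2$ and $\frac{s_2}{s_1}$ is odd, then $\mathcal{C}_D$ has length $n$, dimension $\frac{2s}{s_2}+1$ and the weight distribution - $0:\ 1$ - $n:\ p^{s_2}-1$ - $w:\ m-1$ - $w+\frac{(p^{s_1}-1)\mathcal{G}^2}{p^{s_1}}:\ \frac{p^{s_2}(p^{2s}-1)}{p^{s_1}}+\left(\frac{p^{s_1+s_2}-p^{s_2}}{p^{s_1}}-1\right)(m-1)$ - $n-\frac{p^{2s}+\eta''(-1)\mathcal{G}'\mathcal{G}''\mathcal{G}^2}{p^{s_1+s_2}}:\ \frac{p^{s_1}-1}{2}(p^{2s}-m)\left(p^{s_2-s_1}+\frac{\eta'(-1)\mathcal{G}'\mathcal{G}''}{p^{s_1}}\right)$ - $n-\frac{p^{2s}-\eta''(-1)\mathcal{G}'\mathcal{G}''\mathcal{G}^2}{p^{s_1+s_2}}:\ \frac{p^{s_1}-1}{2}(p^{2s}-m)\left(p^{s_2-s_1}-\frac{\eta'(-1)\mathcal{G}'\mathcal{G}''}{p^{s_1}}\right)$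 Moreover, if $2s>s_1+s_2$, then $\mathcal{C}_D$ is self-orthogonal. (iii) If $s_1\mid s_2$ and $\frac{s_2}{s_1}$ is even, then $\mathcal{C}_D$ has length $n$, dimension $\frac{2s}{s_2}+1$ and the weight distribution - $0:\ 1$ - $n:\ p^{s_2}-1$ - $w:\ m-1$ - $w+\frac{(p^{s_1}-1)\mathcal{G}^2}{p^{s_1}}:\ (p^{s_2}-1)(m-1)$ - $n-\frac{p^{2s}+\eta''(-1)(p^{s_1}-1)\mathcal{G}''\mathcal{G}^2}{p^{s_1+s_2}}:\ \frac{(p^{s_2}-1)(p^{2s}-\mathcal{G}^2)(p^{s_2}+(p^{s_1}-1)\mathcal{G}'')}{2p^{s_1+s_2}}$ - $n-\frac{p^{2s}-\eta''(-1)(p^{s_1}-1)\mathcal{G}''\mathcal{G}^2}{p^{s_1+s_2}}:\ \frac{(p^{s_2}-1)(p^{2s}-\mathcal{G}^2)(p^{s_2}-(p^{s_1}-1)\mathcal{G}'')}{2p^{s_1+s_2}}$ - $n-\frac{p^{2s}-\eta''(-1)\mathcal{G}''\mathcal{G}^2}{p^{s_1+s_2}}:\ \frac{(p^{s_1}-1)(p^{s_2}-1)(p^{2s}-\mathcal{G}^2)(p^{s_2}-\mathcal{G}'')}{2p^{s_1+s_2}}$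 - $n-\frac{p^{2s}+\eta''(-1)\mathcal{G}''\mathcal{G}^2}{p^{s_1+s_2}}:\ \frac{(p^{s_1}-1)(p^{s_2}-1)(p^{2s}-\mathcal{G}^2)(p^{s_2}+\mathcal{G}'')}{2p^{s_1+s_2}}$ Moreover, if $2s>2s_1+s_2$, then $\mathcal{C}_D$ is self-orthogonal. (iv) The dual code $\mathcal{C}_D^\perp$ has length $n$, dimension $n-\left(\frac{2s}{s_2}+1\right)$ and minimum Hamming distance $3$. Moreover, if $s=s_2$, then $\mathcal{C}_D^\perp$ is almost maximum distance separable (AMDS), i.e. its minimum distance equals its length minus its dimension. -/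

import Mathlib

open scoped Classical in
/-- The defining set `D = {(x, y) ∈ F × F : Tr_{F/K₁}(x² + y²) = 0}`. -/
noncomputable def definingSet (K₁ F : Type*) [Field K₁] [Field F] [Fintype F] [Algebra K₁ F] :
    Finset (F × F) :=
  Finset.univ.filter fun v => Algebra.trace K₁ F (v.1 ^ 2 + v.2 ^ 2) = 0

/-- The code `C_D = {(Tr_{F/K₂}(a x + b y))_{(x, y) ∈ D} + c · 1 : a, b ∈ F, c ∈ K₂}` over `K₂`,
whose coordinates are indexed by the points of `D`. -/
noncomputable def codeCD (K₁ K₂ F : Type*) [Field K₁] [Field K₂] [Field F] [Fintype F]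
    [Algebra K₁ F] [Algebra K₂ F] : Submodule K₂ (definingSet K₁ F → K₂) where
  carrier := {w | ∃ (a b : F) (c : K₂), w = fun v : definingSet K₁ F =>
    Algebra.trace K₂ F (a * v.1.1 + b * v.1.2) + c}
  add_mem' := by
    rintro _ _ ⟨a, b, c, rfl⟩ ⟨a', b', c', rfl⟩
    refine ⟨a + a', b + b', c + c', funext fun v => ?_⟩
    simp only [Pi.add_apply, add_mul, map_add]
    ring
  zero_mem' := ⟨0, 0, 0, funext fun v => by simp⟩
  smul_mem' := by
    rintro r _ ⟨a, b, c, rfl⟩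
    refine ⟨r • a, r • b, r * c, funext fun v => ?_⟩
    simp only [Pi.smul_apply, smul_mul_assoc, map_add, map_smul, smul_eq_mul]
    ring

/-- The dual code with respect to the standard inner product. -/
def dualCode {ι K : Type*} [Fintype ι] [Field K] (C : Submodule K (ι → K)) :
    Submodule K (ι → K) where
  carrier := {a | ∀ c ∈ C, a ⬝ᵥ c = 0}
  add_mem' := by
    intro a b ha hb c hc
    rw [add_dotProduct, ha c hc, hb c hc, add_zero]
  zero_mem' := fun c _ => zero_dotProduct c
  smul_mem' := by
    intro r a ha c hc
    rw [smul_dotProduct, ha c hc, smul_zero]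

/-- A code is self-orthogonal if it is contained in its dual. -/
def IsSelfOrthogonal {ι K : Type*} [Fintype ι] [Field K] (C : Submodule K (ι → K)) : Prop :=
  C ≤ dualCode C

open scoped Classical in
/-- `d` is the minimum Hamming distance of `C`: the least weight of a nonzero codeword. -/
def IsMinDist {ι K : Type*} [Fintype ι] [Field K] (C : Submodule K (ι → K)) (d : ℕ) : Prop :=
  IsLeast {w | ∃ c ∈ C, c ≠ 0 ∧ hammingNorm c = w} d

/-- `C` is almost maximum distance separable: an `[n, k, d]` code with `d = n - k`. -/
def IsAMDS {ι K : Type*} [Fintype ι] [Field K] (C : Submodule K (ι → K)) : Prop :=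
  ∃ d : ℕ, IsMinDist C d ∧ d + Module.finrank K C = Fintype.card ι

open scoped Classical in
/-- `A_w`, the number of codewords of Hamming weight `w`. -/
noncomputable def weightCount {ι K : Type*} [Fintype ι] [Field K] (C : Submodule K (ι → K))
    (w : ℕ) : ℕ :=
  Nat.card {c : ι → K // c ∈ C ∧ hammingNorm c = w}

open scoped Classical in
/-- `C` has the weight distribution displayed in the table `T` of rows (weight, frequency).
Rows of equal weight are added up, and weights that do not occur in `T` have `A_w = 0`. -/
def HasWeightDistribution {ι K : Type*} [Fintype ι] [Field K] (C : Submodule K (ι → K))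
    (T : List (ℂ × ℂ)) : Prop :=
  ∀ w : ℕ, (weightCount C w : ℂ) = (T.map fun row => if row.1 = (w : ℂ) then row.2 else 0).sum

/-- The value `(-1)^(t-1) (√-1)^(((p-1)/2)² t) √(p^t)` of the quadratic Gauss sum over the field
with `p ^ t` elements (`p` an odd prime, `t ≥ 1`). -/
noncomputable def gaussValue (p t : ℕ) : ℂ :=
  (-1) ^ (t - 1) * Complex.I ^ (((p - 1) / 2) ^ 2 * t) * ((Real.sqrt ((p : ℝ) ^ t) : ℝ) : ℂ)

/-- `(p^(2s) + (p^t - 1) G²) / p^t` with `G` the quadratic Gauss sum over the field with `p ^ s`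
elements; for `t = s₁` this is the length of `C_D`. -/
noncomputable def quadricCount (p s t : ℕ) : ℂ :=
  ((p : ℂ) ^ (2 * s) + ((p : ℂ) ^ t - 1) * gaussValue p s ^ 2) / (p : ℂ) ^ t

open scoped Classical in
/-- The value `η(-1)` of the quadratic character of the finite field `K`. -/
noncomputable def etaNegOne (K : Type*) [Field K] [Fintype K] : ℂ :=
  ((quadraticChar K (-1) : ℤ) : ℂ)

/-- Weight distribution in the case `s₂ ∣ s₁`. -/
noncomputable def weightTable₁ (p s s₁ s₂ : ℕ) : List (ℂ × ℂ) :=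
  let P : ℂ := p
  let G := gaussValue p s
  let n := quadricCount p s s₁
  let w := P ^ (2 * s) * (P ^ s₂ - 1) / P ^ (s₁ + s₂)
  [(0, 1),
   (n, P ^ s₂ - 1),
   (w, n - 1),
   (w + (P ^ s₁ - 1) * G ^ 2 / P ^ s₁, (P ^ s₂ - 1) * (n - 1)),
   (w + (P ^ (s₁ + s₂) - P ^ s₁) * G ^ 2 / P ^ (s₁ + s₂),
      (P ^ s₁ - 1) * (P ^ (2 * s) - G ^ 2) / P ^ s₁),
   (w + (P ^ (s₁ + s₂) - P ^ s₁ - P ^ s₂) * G ^ 2 / P ^ (s₁ + s₂),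
      (P ^ s₂ - 1) * (P ^ s₁ - 1) * (P ^ (2 * s) - G ^ 2) / P ^ s₁)]

/-- Weight distribution in the case `s₂ / s₁` odd; `e₁ = η'(-1)` and `e₂ = η''(-1)`. -/
noncomputable def weightTable₂ (p s s₁ s₂ : ℕ) (e₁ e₂ : ℂ) : List (ℂ × ℂ) :=
  let P : ℂ := p
  let G := gaussValue p s
  let G₁ := gaussValue p s₁
  let G₂ := gaussValue p s₂
  let n := quadricCount p s s₁
  let m := quadricCount p s s₂
  let w := P ^ (2 * s) * (P ^ s₂ - 1) / P ^ (s₁ + s₂)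
  [(0, 1),
   (n, P ^ s₂ - 1),
   (w, m - 1),
   (w + (P ^ s₁ - 1) * G ^ 2 / P ^ s₁,
      P ^ s₂ * (P ^ (2 * s) - 1) / P ^ s₁
        + ((P ^ (s₁ + s₂) - P ^ s₂) / P ^ s₁ - 1) * (m - 1)),
   (n - (P ^ (2 * s) + e₂ * G₁ * G₂ * G ^ 2) / P ^ (s₁ + s₂),
      (P ^ s₁ - 1) / 2 * (P ^ (2 * s) - m) * (P ^ s₂ / P ^ s₁ + e₁ * G₁ * G₂ / P ^ s₁)),
   (n - (P ^ (2 * s) - e₂ * G₁ * G₂ * G ^ 2) / P ^ (s₁ + s₂),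
      (P ^ s₁ - 1) / 2 * (P ^ (2 * s) - m) * (P ^ s₂ / P ^ s₁ - e₁ * G₁ * G₂ / P ^ s₁))]

/-- Weight distribution in the case `s₂ / s₁` even; `e₂ = η''(-1)`. -/
noncomputable def weightTable₃ (p s s₁ s₂ : ℕ) (e₂ : ℂ) : List (ℂ × ℂ) :=
  let P : ℂ := p
  let G := gaussValue p s
  let G₂ := gaussValue p s₂
  let n := quadricCount p s s₁
  let m := quadricCount p s s₂
  let w := P ^ (2 * s) * (P ^ s₂ - 1) / P ^ (s₁ + s₂)
  [(0, 1),
   (n, P ^ s₂ - 1),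
   (w, m - 1),
   (w + (P ^ s₁ - 1) * G ^ 2 / P ^ s₁, (P ^ s₂ - 1) * (m - 1)),
   (n - (P ^ (2 * s) + e₂ * (P ^ s₁ - 1) * G₂ * G ^ 2) / P ^ (s₁ + s₂),
      (P ^ s₂ - 1) * (P ^ (2 * s) - G ^ 2) * (P ^ s₂ + (P ^ s₁ - 1) * G₂)
        / (2 * P ^ (s₁ + s₂))),
   (n - (P ^ (2 * s) - e₂ * (P ^ s₁ - 1) * G₂ * G ^ 2) / P ^ (s₁ + s₂),
      (P ^ s₂ - 1) * (P ^ (2 * s) - G ^ 2) * (P ^ s₂ - (P ^ s₁ - 1) * G₂)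
        / (2 * P ^ (s₁ + s₂))),
   (n - (P ^ (2 * s) - e₂ * G₂ * G ^ 2) / P ^ (s₁ + s₂),
      (P ^ s₁ - 1) * (P ^ s₂ - 1) * (P ^ (2 * s) - G ^ 2) * (P ^ s₂ - G₂)
        / (2 * P ^ (s₁ + s₂))),
   (n - (P ^ (2 * s) + e₂ * G₂ * G ^ 2) / P ^ (s₁ + s₂),
      (P ^ s₁ - 1) * (P ^ s₂ - 1) * (P ^ (2 * s) - G ^ 2) * (P ^ s₂ + G₂)
        / (2 * P ^ (s₁ + s₂)))]

open scoped Classical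

/-! Write q, q₁, q₂ for the orders of F, K₁, K₂, and e = η(-1)q for the square of a quadratic Gauss
sum over F. Everything rests on counting the zeros on D of an affine function v ↦ Tr(u·v) + c with u
≠ 0. Orthogonality of additive characters of K₁ and K₂ turns q₁q₂ times this number into a double
sum over (l, m) ∈ K₁ × K₂ of exponential sums over F². For l = 0 only m = 0 survives, giving q². For
l ≠ 0, completing both squares gives e·ψ(-m²z/(4l)) with z = u₁² + u₂², because η(l) occurs squared.
So the number is (q² + e·Z)/(q₁q₂), with Z the sum `zeroSum` attached to z and c (`card_zeros`).

Z is evaluated along the tower. If K₂ ⊆ K₁, it depends only on whether Tr_{F/K₁} z and c vanish. If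
K₁ ⊆ K₂ and R = Tr_{F/K₂} z is nonzero, completing the square over K₂ leaves a sum over K₁* of
η₂(l)ψ₁(-lt) with t = Tr_{K₂/K₁}(c²/R). As η₂ restricts to η₁^r on K₁, r = [K₂ : K₁], this is a
Gauss sum over K₁ for odd r and plain orthogonality for even r. The frequencies come from the same
technique applied to the number of u with given trace and of c with given t.

The number of codewords of weight w is the sum of an indicator function g over all (u, c); each
table is the same linear expression in values of g, so coinciding weights add up by themselves. The
signs of Gauss sums are never needed: a sign change only permutes rows, so it is enough that
`gaussValue` has the right square.

Self-orthogonality holds whenever s₁ < s: the counting formula over 𝔽_p makes every fibre on D of a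
nonzero 𝔽_p-linear form divisible by p, which kills all sums over D of linear forms and, by
polarization, of their products. For the dual code, affine functions separate points, so the
distance is at least 3, and the collinear points v, 0, -v of D give weight 3. -/

theorem sum_eq_apply_zero_add {M A : Type*} [Fintype M] [Zero M] [AddCommMonoid A] (f : M → A) :
    ∑ x, f x = f 0 + ∑ x with x ≠ 0, f x := by
  rw [← Finset.add_sum_erase _ f (Finset.mem_univ 0)]
  congr 2
  ext x
  simp

/-! ### Quadratic characters and quadratic exponential sums over one finite field. -/

section QuadraticSums

variable {K : Type*} [Field K] [Fintype K]

/-- The quadratic character of a finite field with complex values. -/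
noncomputable def complexQuadraticChar (K : Type*) [Field K] [Fintype K] : MulChar K ℂ :=
  (quadraticChar K).ringHomComp (Int.castRingHom ℂ)

theorem complexQuadraticChar_apply (a : K) :
    complexQuadraticChar K a = ((quadraticChar K a : ℤ) : ℂ) := rfl

theorem complexQuadraticChar_sq {a : K} (ha : a ≠ 0) : complexQuadraticChar K a ^ 2 = 1 := by
  rw [complexQuadraticChar_apply]
  exact_mod_cast congrArg (Int.cast : ℤ → ℂ) (quadraticChar_sq_one ha)

theorem complexQuadraticChar_mul_self {a : K} (ha : a ≠ 0) :
    complexQuadraticChar K a * complexQuadraticChar K a = 1 := by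
  rw [← sq, complexQuadraticChar_sq ha]

theorem complexQuadraticChar_eq_or {a : K} (ha : a ≠ 0) :
    complexQuadraticChar K a = 1 ∨ complexQuadraticChar K a = -1 :=
  sq_eq_one_iff.mp (complexQuadraticChar_sq ha)

theorem complexQuadraticChar_inv (a : K) :
    complexQuadraticChar K a⁻¹ = complexQuadraticChar K a := by
  rcases eq_or_ne a 0 with rfl | ha
  · simp
  · have h : complexQuadraticChar K a⁻¹ * complexQuadraticChar K a = 1 := by
      rw [← map_mul, inv_mul_cancel₀ ha, map_one]
    calc complexQuadraticChar K a⁻¹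
        = complexQuadraticChar K a⁻¹ * (complexQuadraticChar K a * complexQuadraticChar K a) := by
          rw [complexQuadraticChar_mul_self ha, mul_one]
      _ = _ := by rw [← mul_assoc, h, one_mul]

theorem complexQuadraticChar_ne_one (hK : ringChar K ≠ 2) : complexQuadraticChar K ≠ 1 :=
  (MulChar.ringHomComp_ne_one_iff (Int.cast_injective (α := ℂ))).mpr (quadraticChar_ne_one hK)

theorem complexQuadraticChar_isQuadratic : (complexQuadraticChar K).IsQuadratic :=
  (quadraticChar_isQuadratic K).comp _

/-- The quadratic Gauss sum of an additive character. -/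
noncomputable def quadraticGaussSum (ψ : AddChar K ℂ) : ℂ := gaussSum (complexQuadraticChar K) ψ

theorem quadraticGaussSum_sq (hK : ringChar K ≠ 2) {ψ : AddChar K ℂ} (hψ : ψ.IsPrimitive) :
    quadraticGaussSum ψ ^ 2 = complexQuadraticChar K (-1) * Fintype.card K :=
  gaussSum_sq (complexQuadraticChar_ne_one hK) complexQuadraticChar_isQuadratic hψ

/-- Summing over squares is summing against `1 + η`. -/
theorem sum_sq_eq_sum_quadraticChar (hK : ringChar K ≠ 2) (f : K → ℂ) :
    ∑ x, f (x ^ 2) = ∑ y, (1 + complexQuadraticChar K y) * f y := by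
  rw [← Finset.sum_fiberwise_of_maps_to (g := fun x : K => x ^ 2) (t := Finset.univ)
    (fun _ _ => Finset.mem_univ _)]
  refine Finset.sum_congr rfl fun y _ => ?_
  rw [Finset.sum_congr rfl (g := fun _ => f y)
    (fun x hx => by rw [(Finset.mem_filter.mp hx).2]), Finset.sum_const, nsmul_eq_mul]
  congr 1
  have h := quadraticChar_card_sqrts hK y
  have h2 : ({x : K | x ^ 2 = y} : Set K).toFinset = Finset.univ.filter fun x => x ^ 2 = y := by
    ext; simp
  rw [h2] at h
  rw [complexQuadraticChar_apply, add_comm]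
  exact_mod_cast congrArg (Int.cast : ℤ → ℂ) h

theorem sum_addChar_eq_zero {ψ : AddChar K ℂ} (hψ : ψ.IsPrimitive) {a : K} (ha : a ≠ 0) :
    ∑ x, ψ (a * x) = 0 := by
  have := AddChar.sum_mulShift a hψ
  simpa [mul_comm, ha] using this

theorem sum_addChar_mul {ψ : AddChar K ℂ} (hψ : ψ.IsPrimitive) (a : K) :
    ∑ x, ψ (x * a) = if a = 0 then (Fintype.card K : ℂ) else 0 := by
  rw [AddChar.sum_mulShift a hψ]
  split_ifs <;> simp

theorem sum_ne_zero_addChar_mul {ψ : AddChar K ℂ} (hψ : ψ.IsPrimitive) (a : K) :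
    ∑ x with x ≠ 0, ψ (x * a) = (if a = 0 then (Fintype.card K : ℂ) else 0) - 1 := by
  rw [← sum_addChar_mul hψ, sum_eq_apply_zero_add fun x => ψ (x * a), zero_mul,
    AddChar.map_zero_eq_one, add_sub_cancel_left]

theorem sum_quadraticChar_mul_addChar {ψ : AddChar K ℂ} (a : K) (hK : ringChar K ≠ 2) :
    ∑ x, complexQuadraticChar K x * ψ (x * a) =
      complexQuadraticChar K a * quadraticGaussSum ψ := by
  rcases eq_or_ne a 0 with rfl | ha
  · simp only [mul_zero, AddChar.map_zero_eq_one, mul_one, MulChar.map_zero, zero_mul]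
    exact MulChar.sum_eq_zero_of_ne_one (complexQuadraticChar_ne_one hK)
  · have h := gaussSum_mulShift (complexQuadraticChar K) ψ (Units.mk0 a ha)
    rw [Units.val_mk0] at h
    rw [quadraticGaussSum, ← h, ← mul_assoc, complexQuadraticChar_mul_self ha, one_mul, gaussSum]
    simp [AddChar.mulShift_apply, mul_comm]

theorem sum_addChar_mul_sq (hK : ringChar K ≠ 2) {ψ : AddChar K ℂ} (hψ : ψ.IsPrimitive)
    {a : K} (ha : a ≠ 0) :
    ∑ x, ψ (a * x ^ 2) = complexQuadraticChar K a * quadraticGaussSum ψ := by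
  rw [sum_sq_eq_sum_quadraticChar hK fun y => ψ (a * y)]
  simp only [add_mul, one_mul, Finset.sum_add_distrib]
  rw [sum_addChar_eq_zero hψ ha, zero_add, ← sum_quadraticChar_mul_addChar a hK]
  simp only [mul_comm a]

/-- The complete quadratic sum, by completing the square. -/
theorem sum_addChar_quadratic (hK : ringChar K ≠ 2) {ψ : AddChar K ℂ} (hψ : ψ.IsPrimitive)
    {a : K} (ha : a ≠ 0) (b : K) :
    ∑ x, ψ (a * x ^ 2 + b * x) =
      complexQuadraticChar K a * quadraticGaussSum ψ * ψ (-(b ^ 2 / (4 * a))) := by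
  have h2 : (2 : K) ≠ 0 := Ring.two_ne_zero hK
  have h4 : (4 : K) ≠ 0 := by
    have : (4 : K) = 2 * 2 := by norm_num
    rw [this]; exact mul_ne_zero h2 h2
  rw [← sum_addChar_mul_sq hK hψ ha, Finset.sum_mul]
  refine Fintype.sum_equiv (Equiv.addRight (b / (2 * a))) _ _ fun x => ?_
  rw [← AddChar.map_add_eq_mul]
  congr 1
  simp only [Equiv.coe_addRight]
  field_simp
  ring

/-- The quadratic exponential sum of the plane form `x² + y²`. -/
theorem sum_addChar_plane (hK : ringChar K ≠ 2) {ψ : AddChar K ℂ} (hψ : ψ.IsPrimitive)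
    {l : K} (hl : l ≠ 0) (u : K × K) :
    ∑ v : K × K, ψ (l * (v.1 ^ 2 + v.2 ^ 2) + (u.1 * v.1 + u.2 * v.2)) =
      complexQuadraticChar K (-1) * Fintype.card K * ψ (-((u.1 ^ 2 + u.2 ^ 2) / (4 * l))) := by
  have h : ∀ v : K × K, ψ (l * (v.1 ^ 2 + v.2 ^ 2) + (u.1 * v.1 + u.2 * v.2)) =
      ψ (l * v.1 ^ 2 + u.1 * v.1) * ψ (l * v.2 ^ 2 + u.2 * v.2) := by
    intro v
    rw [← AddChar.map_add_eq_mul]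
    congr 1
    ring
  simp only [h]
  rw [Fintype.sum_prod_type]
  simp only [← Finset.mul_sum, ← Finset.sum_mul]
  rw [sum_addChar_quadratic hK hψ hl, sum_addChar_quadratic hK hψ hl, ← quadraticGaussSum_sq hK hψ,
    add_div, neg_add_rev, AddChar.map_add_eq_mul]
  -- Two variables produce η(l)² = 1, so the Gauss factor does not depend on `l`.
  linear_combination (quadraticGaussSum ψ ^ 2 * ψ (-(u.1 ^ 2 / (4 * l))) *
    ψ (-(u.2 ^ 2 / (4 * l)))) * complexQuadraticChar_sq hl

/-- Without the quadratic term, the exponential sum over the plane detects `u = 0`. -/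
theorem sum_addChar_plane_linear {ψ : AddChar K ℂ} (hψ : ψ.IsPrimitive) (u : K × K) :
    ∑ v : K × K, ψ (u.1 * v.1 + u.2 * v.2) =
      if u = 0 then (Fintype.card K : ℂ) ^ 2 else 0 := by
  simp only [AddChar.map_add_eq_mul]
  rw [Fintype.sum_prod_type]
  simp only [← Finset.mul_sum, ← Finset.sum_mul, mul_comm u.1, mul_comm u.2]
  rw [sum_addChar_mul hψ, sum_addChar_mul hψ]
  simp only [Prod.ext_iff, Prod.fst_zero, Prod.snd_zero]
  split_ifs <;> simp_all [sq]

/-- Half of the nonzero elements are squares. -/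
theorem sum_ne_zero_quadraticChar (hK : ringChar K ≠ 2) (f : ℂ → ℂ) :
    ∑ x : K with x ≠ 0, f (complexQuadraticChar K x) =
      ((Fintype.card K : ℂ) - 1) / 2 * (f 1 + f (-1)) := by
  have h : ∀ x ∈ Finset.univ.filter fun x : K => x ≠ 0, f (complexQuadraticChar K x) =
      (f 1 + f (-1)) / 2 + complexQuadraticChar K x * ((f 1 - f (-1)) / 2) := by
    intro x hx
    rcases complexQuadraticChar_eq_or (Finset.mem_filter.mp hx).2 with h | h <;> rw [h] <;> ring
  have h0 : ∑ x : K with x ≠ 0, complexQuadraticChar K x = 0 := by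
    rw [Finset.sum_filter_of_ne, MulChar.sum_eq_zero_of_ne_one (complexQuadraticChar_ne_one hK)]
    rintro x - hx rfl
    exact hx (MulChar.map_zero _)
  rw [Finset.sum_congr rfl h, Finset.sum_add_distrib, ← Finset.sum_mul, h0, zero_mul, add_zero,
    Finset.sum_const, nsmul_eq_mul, Finset.filter_ne', Finset.card_erase_of_mem (Finset.mem_univ _),
    Finset.card_univ, Nat.cast_sub Fintype.card_pos]
  push_cast
  ring

end QuadraticSums

/-! ### Counting points of the quadric and zeros of affine functions on it. -/

section Traces

variable {K₁ K₂ F : Type*} [Field K₁] [Fintype K₁] [Field K₂] [Fintype K₂] [Field F]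
  [Algebra K₁ F] [Algebra K₂ F]

/-- The left side detects Tr z = -c by orthogonality. By linearity of the trace the scalar `l` moves
inside it, so that sums over z become exponential sums over F. -/
theorem sum_addChar_mul_trace {ψ : AddChar F ℂ} {ψ₁ : AddChar K₁ ℂ}
    (h₁ : ∀ z, ψ z = ψ₁ (Algebra.trace K₁ F z)) (z : F) (c : K₁) :
    ∑ l, ψ₁ (l * (Algebra.trace K₁ F z + c)) =
      ∑ l, ψ (algebraMap K₁ F l * z) * ψ₁ (l * c) := by
  refine Finset.sum_congr rfl fun l _ => ?_
  rw [h₁, ← AddChar.map_add_eq_mul, ← Algebra.smul_def, map_smul, smul_eq_mul, mul_add]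

variable [Fintype F]

/-- The number of points of the plane with prescribed relative trace of `x² + y²`. -/
theorem card_trace_plane (hF : ringChar F ≠ 2) {ψ : AddChar F ℂ} {ψ₁ : AddChar K₁ ℂ}
    (hψ : ψ.IsPrimitive) (hψ₁ : ψ₁.IsPrimitive) (h₁ : ∀ z, ψ z = ψ₁ (Algebra.trace K₁ F z))
    (t : K₁) :
    (Fintype.card K₁ : ℂ) *
        (Finset.univ.filter fun v : F × F => Algebra.trace K₁ F (v.1 ^ 2 + v.2 ^ 2) = t).card =
      (Fintype.card F : ℂ) ^ 2 + complexQuadraticChar F (-1) * Fintype.card F *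
        ((if t = 0 then (Fintype.card K₁ : ℂ) else 0) - 1) := by
  have key : ∑ v : F × F, ∑ l : K₁, ψ (algebraMap K₁ F l * (v.1 ^ 2 + v.2 ^ 2)) * ψ₁ (l * -t) =
      (Fintype.card K₁ : ℂ) *
        (Finset.univ.filter fun v : F × F => Algebra.trace K₁ F (v.1 ^ 2 + v.2 ^ 2) = t).card := by
    simp only [← sum_addChar_mul_trace h₁, sum_addChar_mul hψ₁]
    rw [← Finset.sum_filter, Finset.sum_const, nsmul_eq_mul, mul_comm]
    simp only [← sub_eq_add_neg, sub_eq_zero]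
  rw [← key, Finset.sum_comm, sum_eq_apply_zero_add]
  congr 1
  · simp [sq]
  · have h : ∀ l ∈ Finset.univ.filter fun l : K₁ => l ≠ 0,
        ∑ v : F × F, ψ (algebraMap K₁ F l * (v.1 ^ 2 + v.2 ^ 2)) * ψ₁ (l * -t) =
          complexQuadraticChar F (-1) * Fintype.card F * ψ₁ (l * -t) := by
      intro l hl
      have hl' : algebraMap K₁ F l ≠ 0 := by simpa using (Finset.mem_filter.mp hl).2
      rw [← Finset.sum_mul]
      have := sum_addChar_plane hF hψ hl' (0 : F × F)
      simp only [Prod.fst_zero, Prod.snd_zero, zero_mul, add_zero] at this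
      rw [this]
      simp
    rw [Finset.sum_congr rfl h, ← Finset.mul_sum, sum_ne_zero_addChar_mul hψ₁]
    simp

/-- The exponential sum that governs the zeros on the quadric of an affine function whose
gradient has norm `z`. -/
noncomputable def zeroSum (K₁ : Type*) {K₂ F : Type*} [Field K₁] [Fintype K₁] [Field K₂]
    [Fintype K₂] [Field F] [Algebra K₁ F] [Algebra K₂ F]
    (ψ : AddChar F ℂ) (ψ₂ : AddChar K₂ ℂ) (z : F) (c : K₂) : ℂ :=
  ∑ l : K₁ with l ≠ 0, ∑ m : K₂,
    ψ (algebraMap K₁ F l * (algebraMap K₂ F m ^ 2 * z)) * ψ₂ (m * c)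

/-- The number of zeros on the quadric of a nonconstant affine function. -/
theorem card_zeros (hF : ringChar F ≠ 2) (hK₁ : ringChar K₁ ≠ 2)
    {ψ : AddChar F ℂ} {ψ₁ : AddChar K₁ ℂ} {ψ₂ : AddChar K₂ ℂ}
    (hψ : ψ.IsPrimitive) (hψ₁ : ψ₁.IsPrimitive) (hψ₂ : ψ₂.IsPrimitive)
    (h₁ : ∀ z, ψ z = ψ₁ (Algebra.trace K₁ F z)) (h₂ : ∀ z, ψ z = ψ₂ (Algebra.trace K₂ F z))
    {u : F × F} (hu : u ≠ 0) (c : K₂) :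
    (Fintype.card K₁ : ℂ) * Fintype.card K₂ *
        ((definingSet K₁ F).filter fun v =>
          Algebra.trace K₂ F (u.1 * v.1 + u.2 * v.2) + c = 0).card =
      (Fintype.card F : ℂ) ^ 2 + complexQuadraticChar F (-1) * Fintype.card F *
        zeroSum K₁ ψ ψ₂ (u.1 ^ 2 + u.2 ^ 2) c := by
  have h4 : (4 : K₁) ≠ 0 := by
    have : (4 : K₁) = 2 * 2 := by norm_num
    rw [this]; exact mul_ne_zero (Ring.two_ne_zero hK₁) (Ring.two_ne_zero hK₁)
  have h4F : (4 : F) ≠ 0 := by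
    have h := (map_ne_zero (algebraMap K₁ F)).mpr h4
    rwa [map_ofNat] at h
  -- The first factor detects membership in the quadric, the second a zero of the affine function.
  have key : ∑ v : F × F, (∑ l : K₁, ψ (algebraMap K₁ F l * (v.1 ^ 2 + v.2 ^ 2)) * ψ₁ (l * 0)) *
      (∑ m : K₂, ψ (algebraMap K₂ F m * (u.1 * v.1 + u.2 * v.2)) * ψ₂ (m * c)) =
      (Fintype.card K₁ : ℂ) * Fintype.card K₂ *
        ((definingSet K₁ F).filter fun v =>
          Algebra.trace K₂ F (u.1 * v.1 + u.2 * v.2) + c = 0).card := by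
    simp only [← sum_addChar_mul_trace h₁, ← sum_addChar_mul_trace h₂, sum_addChar_mul hψ₁,
      sum_addChar_mul hψ₂, add_zero]
    simp only [ite_mul, mul_ite, zero_mul, mul_zero]
    simp only [← Finset.sum_filter]
    rw [Finset.sum_const, nsmul_eq_mul, mul_comm, definingSet, Finset.filter_comm]
  have hexp : ∀ (l : K₁) (m : K₂), ∑ v : F × F, ψ (algebraMap K₁ F l * (v.1 ^ 2 + v.2 ^ 2)) *
      (ψ (algebraMap K₂ F m * (u.1 * v.1 + u.2 * v.2)) * ψ₂ (m * c)) =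
      (∑ v : F × F, ψ (algebraMap K₁ F l * (v.1 ^ 2 + v.2 ^ 2) +
        (algebraMap K₂ F m * u.1 * v.1 + algebraMap K₂ F m * u.2 * v.2))) * ψ₂ (m * c) := by
    intro l m
    rw [Finset.sum_mul]
    refine Finset.sum_congr rfl fun v _ => ?_
    rw [← mul_assoc, ← AddChar.map_add_eq_mul]
    congr 3
    ring
  rw [← key]
  simp only [mul_zero, AddChar.map_zero_eq_one, mul_one, Finset.sum_mul_sum]
  rw [Finset.sum_comm, sum_eq_apply_zero_add]
  congr 1
  · rw [Finset.sum_comm]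
    simp only [hexp]
    -- Terms with l = 0 carry no quadratic part: the sum over the plane vanishes unless m·u = 0,
    -- that is m = 0.
    rw [Finset.sum_eq_single (0 : K₂)]
    · simp [sq]
    · intro m _ hm
      simp only [map_zero, zero_mul, zero_add]
      have := sum_addChar_plane_linear hψ (algebraMap K₂ F m • u)
      simp only [Prod.smul_fst, Prod.smul_snd, smul_eq_mul] at this
      rw [this, if_neg, zero_mul]
      rw [smul_eq_zero, not_or]
      exact ⟨by simpa using hm, hu⟩
    · simp
  · have h : ∀ l ∈ Finset.univ.filter fun l : K₁ => l ≠ 0, ∑ v : F × F, ∑ m : K₂,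
        ψ (algebraMap K₁ F l * (v.1 ^ 2 + v.2 ^ 2)) *
        (ψ (algebraMap K₂ F m * (u.1 * v.1 + u.2 * v.2)) * ψ₂ (m * c)) =
        complexQuadraticChar F (-1) * Fintype.card F * ∑ m : K₂,
          ψ (algebraMap K₁ F (-(4 * l)⁻¹) * (algebraMap K₂ F m ^ 2 * (u.1 ^ 2 + u.2 ^ 2))) *
            ψ₂ (m * c) := by
      intro l hl
      have hl' : algebraMap K₁ F l ≠ 0 := by simpa using (Finset.mem_filter.mp hl).2
      rw [Finset.sum_comm, Finset.mul_sum]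
      refine Finset.sum_congr rfl fun m _ => ?_
      rw [hexp]
      have := sum_addChar_plane hF hψ hl' (algebraMap K₂ F m * u.1, algebraMap K₂ F m * u.2)
      rw [this, mul_assoc]
      congr 3
      simp only [map_neg, map_inv₀, map_mul, map_ofNat]
      field_simp
    rw [Finset.sum_congr rfl h, ← Finset.mul_sum, zeroSum]
    congr 1
    -- The map l ↦ -1/(4l) is an involution of K₁*; reindexing by it removes the denominator left by
    -- completing the square.
    have hinv : ∀ l : K₁, -(4 * -(4 * l)⁻¹)⁻¹ = l := by
      intro l
      rcases eq_or_ne l 0 with rfl | hl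
      · simp
      · field_simp
    refine Finset.sum_nbij' (fun l => -(4 * l)⁻¹) (fun l => -(4 * l)⁻¹) ?_ ?_ ?_ ?_ ?_
    · intro l hl
      simpa [h4] using hl
    · intro l hl
      simpa [h4] using hl
    · intro l _
      exact hinv l
    · intro l _
      exact hinv l
    · intro l _
      rfl

end Traces

/-! ### Nested finite subfields and restriction of the quadratic character. -/

section Subfields

/-- A finite subfield is cut out by its Frobenius. -/
theorem mem_fieldRange_of_pow_card {K F : Type*} [Field K] [Fintype K] [Field F] [Algebra K F]
    {y : F} (hy : y ^ Fintype.card K = y) : y ∈ (algebraMap K F).fieldRange := by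
  have hq : 1 < Fintype.card K := Fintype.one_lt_card
  have hne := FiniteField.X_pow_card_sub_X_ne_zero F hq
  have hsub : Finset.univ.image (algebraMap K F) ⊆
      (Polynomial.X ^ Fintype.card K - Polynomial.X : Polynomial F).roots.toFinset := by
    intro z hz
    obtain ⟨x, -, rfl⟩ := Finset.mem_image.mp hz
    simp [hne, Polynomial.IsRoot, ← map_pow, FiniteField.pow_card]
  -- The polynomial X^q - X has at most q roots, and the image of K already supplies q of them.
  have heq := Finset.eq_of_subset_of_card_le hsub (by
    rw [Finset.card_image_of_injective _ (algebraMap K F).injective, Finset.card_univ]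
    refine (Multiset.toFinset_card_le _).trans ((Polynomial.card_roots' _).trans ?_)
    rw [FiniteField.X_pow_card_sub_X_natDegree_eq F hq])
  have : y ∈ Finset.univ.image (algebraMap K F) := by
    rw [heq]
    simp [hne, Polynomial.IsRoot, hy]
  obtain ⟨x, -, rfl⟩ := Finset.mem_image.mp this
  exact ⟨x, rfl⟩

/-- Two finite subfields whose cardinalities are nested are nested. -/
theorem exists_ringHom_of_card {K₁ K₂ F : Type*} [Field K₁] [Fintype K₁] [Field K₂] [Fintype K₂]
    [Field F] [Algebra K₁ F] [Algebra K₂ F] {r : ℕ}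
    (h : Fintype.card K₂ = Fintype.card K₁ ^ r) :
    ∃ f : K₁ →+* K₂, ∀ x, algebraMap K₂ F (f x) = algebraMap K₁ F x := by
  have hmem : ∀ x, algebraMap K₁ F x ∈ (algebraMap K₂ F).range := by
    intro x
    have := mem_fieldRange_of_pow_card (K := K₂) (y := algebraMap K₁ F x)
      (by rw [h, ← map_pow, FiniteField.pow_card_pow])
    exact this
  let e : K₂ ≃+* (algebraMap K₂ F).range :=
    RingEquiv.ofBijective (algebraMap K₂ F).rangeRestrict
      ⟨fun a b hab => (algebraMap K₂ F).injective (congrArg Subtype.val hab),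
        (algebraMap K₂ F).rangeRestrict_surjective⟩
  refine ⟨e.symm.toRingHom.comp ((algebraMap K₁ F).codRestrict _ hmem), fun x => ?_⟩
  have := e.apply_symm_apply ((algebraMap K₁ F).codRestrict _ hmem x)
  exact congrArg Subtype.val this

/-- Allows an identity between signs to be checked inside the field, where Euler's criterion
computes the quadratic character. -/
theorem intCast_injOn_sign {L : Type*} [Field L] (hL : ringChar L ≠ 2) {a b : ℤ} (ha : a = 1 ∨ a = -1)
    (hb : b = 1 ∨ b = -1) (h : (a : L) = b) : a = b := by
  have h2 := Ring.neg_one_ne_one_of_char_ne_two hL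
  rcases ha with rfl | rfl <;> rcases hb with rfl | rfl <;> simp_all [eq_comm]

theorem ringChar_eq_of_algebra {K L : Type*} [Field K] [Field L] [Algebra K L] : ringChar L = ringChar K := by
  have := ringChar.charP K
  have : CharP L (ringChar K) := charP_of_injective_algebraMap (algebraMap K L).injective _
  exact (ringChar.eq L (ringChar K)).symm ▸ rfl

variable {K L : Type*} [Field K] [Fintype K] [Field L] [Fintype L] [Algebra K L]

/-- The quadratic character of an extension of degree `r`, restricted to the base field, is the
`r`-th power of the quadratic character of the base field. -/
theorem quadraticChar_algebraMap (hK : ringChar K ≠ 2) {r : ℕ}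
    (h : Fintype.card L = Fintype.card K ^ r) {x : K} (hx : x ≠ 0) :
    quadraticChar L (algebraMap K L x) = quadraticChar K x ^ r := by
  have hL : ringChar L ≠ 2 := by rwa [ringChar_eq_of_algebra (K := K)]
  have hx' : algebraMap K L x ≠ 0 := by simpa using hx
  refine intCast_injOn_sign hL (quadraticChar_dichotomy hx') ?_ ?_
  · rcases quadraticChar_dichotomy hx with h | h <;> rw [h]
    · simp
    · exact neg_one_pow_eq_or ℤ r
  · rw [quadraticChar_eq_pow_of_char_ne_two' hL, h, ← map_pow]
    have hodd : Odd (Fintype.card K) := Nat.odd_iff.mpr (FiniteField.odd_card_of_char_ne_two hK)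
    obtain ⟨k, hk⟩ := hodd
    have hk2 : Fintype.card K / 2 = k := by omega
    -- Hence (q^r - 1)/2 = (q - 1)/2 · (1 + q + ... + q^(r-1)). Each of the r powers of q is odd, so
    -- each contributes one factor η(x).
    have hgeom : Fintype.card K ^ r = 2 * (k * ∑ i ∈ Finset.range r, Fintype.card K ^ i) + 1 := by
      have h3 := geom_sum_mul_add (2 * k) r
      rw [hk]
      linarith
    have hdiv : Fintype.card K ^ r / 2 = k * ∑ i ∈ Finset.range r, Fintype.card K ^ i := by omega
    rw [hdiv, pow_mul, ← hk2, ← quadraticChar_eq_pow_of_char_ne_two' hK]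
    have hpow : ∀ i, (quadraticChar K x) ^ (Fintype.card K ^ i) = quadraticChar K x := by
      intro i
      rcases quadraticChar_dichotomy hx with h | h <;> rw [h]
      · simp
      · exact (Odd.pow (Nat.odd_iff.mpr (FiniteField.odd_card_of_char_ne_two hK))).neg_one_pow
    rw [← Int.cast_pow, ← Finset.prod_pow_eq_pow_sum, Finset.prod_congr rfl fun i _ => hpow i]
    simp

end Subfields

/-! ### Canonical additive characters, compatible along traces. -/

section TraceCharacters

variable (p : ℕ) [Fact p.Prime] (K : Type*) [Field K] [Algebra (ZMod p) K]

/-- The canonical additive character of a finite field. -/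
noncomputable def traceChar : AddChar K ℂ :=
  (ZMod.stdAddChar (N := p)).compAddMonoidHom (Algebra.trace (ZMod p) K).toAddMonoidHom

theorem traceChar_apply (z : K) :
    traceChar p K z = ZMod.stdAddChar (Algebra.trace (ZMod p) K z) := rfl

theorem traceChar_isPrimitive [Finite K] : (traceChar p K).IsPrimitive := by
  refine AddChar.IsPrimitive.of_ne_one ?_
  have : Module.Finite (ZMod p) K := Module.Finite.of_finite
  obtain ⟨z, hz⟩ := Algebra.trace_surjective (ZMod p) K 1
  rw [AddChar.ne_one_iff]
  refine ⟨z, fun h => ?_⟩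
  rw [traceChar_apply, hz, ← AddChar.map_zero_eq_one (ZMod.stdAddChar (N := p))] at h
  exact one_ne_zero (ZMod.injective_stdAddChar h)

theorem traceChar_trace {F : Type*} [Finite K] [Field F] [Finite F] [Algebra (ZMod p) F]
    [Algebra K F] (z : F) : traceChar p F z = traceChar p K (Algebra.trace K F z) := by
  -- There is at most one ring homomorphism out of `ZMod p`, so compatibility of the algebra
  -- structures is automatic.
  have : IsScalarTower (ZMod p) K F :=
    IsScalarTower.of_algebraMap_eq' (Subsingleton.elim _ _)
  have : Module.Finite (ZMod p) K := Module.Finite.of_finite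
  have : Module.Finite K F := Module.Finite.of_finite
  rw [traceChar_apply, traceChar_apply, Algebra.trace_trace]

end TraceCharacters

/-! ### Evaluation of the zero sum in the possible towers. -/

section ZeroSums

variable {K₁ K₂ F : Type*} [Field K₁] [Fintype K₁] [Field K₂] [Fintype K₂] [Field F]
  [Algebra K₁ F] [Algebra K₂ F]
  {ψ : AddChar F ℂ} {ψ₁ : AddChar K₁ ℂ} {ψ₂ : AddChar K₂ ℂ}

/-- Summing over `l` first is orthogonality on K₁ with the term l = 0 left out. -/
theorem zeroSum_eq (hψ₁ : ψ₁.IsPrimitive) (h₁ : ∀ z, ψ z = ψ₁ (Algebra.trace K₁ F z))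
    (z : F) (c : K₂) :
    zeroSum K₁ ψ ψ₂ z c = ∑ m : K₂,
      ((if Algebra.trace K₁ F (algebraMap K₂ F m ^ 2 * z) = 0 then (Fintype.card K₁ : ℂ) else 0)
        - 1) * ψ₂ (m * c) := by
  rw [zeroSum, Finset.sum_comm]
  refine Finset.sum_congr rfl fun m _ => ?_
  rw [← Finset.sum_mul, ← sum_ne_zero_addChar_mul hψ₁]
  congr 1
  refine Finset.sum_congr rfl fun l _ => ?_
  rw [h₁, ← Algebra.smul_def, map_smul, smul_eq_mul]

/-- Needs no inclusion between K₁ and K₂; bounds on the cardinality on the right are all that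
injectivity of the encoding requires. -/
theorem zeroSum_zero (hψ₁ : ψ₁.IsPrimitive) (h₁ : ∀ z, ψ z = ψ₁ (Algebra.trace K₁ F z)) (z : F) :
    zeroSum K₁ ψ ψ₂ z 0 = (Fintype.card K₁ : ℂ) * (Finset.univ.filter fun m : K₂ =>
      Algebra.trace K₁ F (algebraMap K₂ F m ^ 2 * z) = 0).card - Fintype.card K₂ := by
  rw [zeroSum_eq hψ₁ h₁]
  simp [Finset.sum_sub_distrib, ← Finset.sum_filter, mul_comm]

/-- The values of the zero sum when the code alphabet is contained in the field of the trace. -/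
theorem zeroSum_of_le [Algebra K₂ K₁] [IsScalarTower K₂ K₁ F] (hψ₁ : ψ₁.IsPrimitive)
    (hψ₂ : ψ₂.IsPrimitive) (h₁ : ∀ z, ψ z = ψ₁ (Algebra.trace K₁ F z)) (z : F) (c : K₂) :
    zeroSum K₁ ψ ψ₂ z c = if Algebra.trace K₁ F z = 0 then
        ((Fintype.card K₁ : ℂ) - 1) * (if c = 0 then (Fintype.card K₂ : ℂ) else 0)
      else (Fintype.card K₁ : ℂ) - if c = 0 then (Fintype.card K₂ : ℂ) else 0 := by
  have htr : ∀ m : K₂, Algebra.trace K₁ F (algebraMap K₂ F m ^ 2 * z) =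
      algebraMap K₂ K₁ m ^ 2 * Algebra.trace K₁ F z := by
    intro m
    rw [IsScalarTower.algebraMap_apply K₂ K₁ F, ← map_pow, ← Algebra.smul_def, map_smul,
      smul_eq_mul]
  rw [zeroSum_eq hψ₁ h₁, ← sum_addChar_mul hψ₂]
  simp only [htr]
  split_ifs with h
  · simp only [h, mul_zero, if_true, ← Finset.mul_sum]
  · simp only [mul_eq_zero, h, or_false, sub_mul, one_mul, Finset.sum_sub_distrib, ite_mul,
      zero_mul]
    congr 1
    rw [Finset.sum_eq_single (0 : K₂)]
    · simp
    · intro m _ hm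
      simp [hm]
    · simp

/-- The zero sum for the tower `K₁ ⊆ K₂`, when the relative trace of the norm vanishes. -/
theorem zeroSum_of_trace_eq_zero [Algebra K₁ K₂] [IsScalarTower K₁ K₂ F]
    (hψ₂ : ψ₂.IsPrimitive) (h₂ : ∀ z, ψ z = ψ₂ (Algebra.trace K₂ F z)) {z : F}
    (hz : Algebra.trace K₂ F z = 0) (c : K₂) :
    zeroSum K₁ ψ ψ₂ z c =
      ((Fintype.card K₁ : ℂ) - 1) * (if c = 0 then (Fintype.card K₂ : ℂ) else 0) := by
  have hone : ∀ (l : K₁) (m : K₂), ψ (algebraMap K₁ F l * (algebraMap K₂ F m ^ 2 * z)) = 1 := by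
    intro l m
    rw [h₂, IsScalarTower.algebraMap_apply K₁ K₂ F, ← map_pow, ← mul_assoc, ← map_mul,
      ← Algebra.smul_def, map_smul, hz, smul_zero, AddChar.map_zero_eq_one]
  simp only [zeroSum, hone, one_mul, sum_addChar_mul hψ₂]
  rw [Finset.sum_const, nsmul_eq_mul]
  congr 1
  rw [Finset.filter_ne', Finset.card_erase_of_mem (Finset.mem_univ _),
    Finset.card_univ, Nat.cast_sub Fintype.card_pos, Nat.cast_one]

/-- The zero sum for the tower `K₁ ⊆ K₂` as a sum over `K₁`. -/
theorem zeroSum_of_trace_ne_zero [Algebra K₁ K₂] [IsScalarTower K₁ K₂ F] (hK₂ : ringChar K₂ ≠ 2)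
    (hψ₂ : ψ₂.IsPrimitive) (h₂ : ∀ z, ψ z = ψ₂ (Algebra.trace K₂ F z))
    (h₁₂ : ∀ z, ψ₂ z = ψ₁ (Algebra.trace K₁ K₂ z)) {z : F}
    (hz : Algebra.trace K₂ F z ≠ 0) (c : K₂) :
    zeroSum K₁ ψ ψ₂ z c = complexQuadraticChar K₂ (Algebra.trace K₂ F z) * quadraticGaussSum ψ₂ *
      ∑ l : K₁ with l ≠ 0, complexQuadraticChar K₂ (algebraMap K₁ K₂ l) *
        ψ₁ (-(l * Algebra.trace K₁ K₂ (c ^ 2 / Algebra.trace K₂ F z))) := by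
  have h4 : (4 : K₂) ≠ 0 := by
    have : (4 : K₂) = 2 * 2 := by norm_num
    rw [this]; exact mul_ne_zero (Ring.two_ne_zero hK₂) (Ring.two_ne_zero hK₂)
  have h4' : (4 : K₁) ≠ 0 := by
    intro h
    apply h4
    rw [← map_ofNat (algebraMap K₁ K₂), h, map_zero]
  set R := Algebra.trace K₂ F z with hR
  -- Completing the square over K₂ in the variable `m`. The right side is written in terms of
  -- (4l)⁻¹, an involution of K₁* that is then used to reindex; η₂ sees neither the inversion nor
  -- the square 4.
  have hstep : ∀ l ∈ Finset.univ.filter fun l : K₁ => l ≠ 0, ∑ m : K₂,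
      ψ (algebraMap K₁ F l * (algebraMap K₂ F m ^ 2 * z)) * ψ₂ (m * c) =
      complexQuadraticChar K₂ R * quadraticGaussSum ψ₂ *
        (complexQuadraticChar K₂ (algebraMap K₁ K₂ (4 * l)⁻¹) *
        ψ₁ (-((4 * l)⁻¹ * Algebra.trace K₁ K₂ (c ^ 2 / R)))) := by
    intro l hl
    have hl' : algebraMap K₁ K₂ l ≠ 0 := by simpa using (Finset.mem_filter.mp hl).2
    have h := sum_addChar_quadratic hK₂ hψ₂ (mul_ne_zero hl' hz) c
    rw [map_inv₀, complexQuadraticChar_inv, map_mul, map_mul, map_ofNat,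
      show complexQuadraticChar K₂ 4 = 1 by
        have : (4 : K₂) = 2 * 2 := by norm_num
        rw [this, map_mul, complexQuadraticChar_mul_self (Ring.two_ne_zero hK₂)], one_mul]
    rw [map_mul] at h
    have e : -((4 * l)⁻¹ * Algebra.trace K₁ K₂ (c ^ 2 / R)) =
        Algebra.trace K₁ K₂ (-(c ^ 2 / (4 * (algebraMap K₁ K₂ l * R)))) := by
      rw [← smul_eq_mul, ← map_smul, ← map_neg, Algebra.smul_def, map_inv₀, map_mul, map_ofNat]
      congr 2
      field_simp
    rw [e, ← h₁₂]
    rw [← mul_assoc, mul_right_comm (complexQuadraticChar K₂ R),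
      mul_comm (complexQuadraticChar K₂ R), ← h]
    refine Finset.sum_congr rfl fun m _ => ?_
    have htr : Algebra.trace K₂ F (algebraMap K₁ F l * (algebraMap K₂ F m ^ 2 * z)) =
        algebraMap K₁ K₂ l * m ^ 2 * R := by
      rw [IsScalarTower.algebraMap_apply K₁ K₂ F, ← map_pow, ← mul_assoc, ← map_mul,
        ← Algebra.smul_def, map_smul, smul_eq_mul]
    rw [h₂, htr, ← AddChar.map_add_eq_mul]
    congr 1
    ring
  rw [zeroSum, Finset.sum_congr rfl hstep, ← Finset.mul_sum]
  congr 1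
  refine Finset.sum_nbij' (fun l => (4 * l)⁻¹) (fun l => (4 * l)⁻¹) ?_ ?_ ?_ ?_ ?_
  · intro l hl
    simpa [h4'] using hl
  · intro l hl
    simpa [h4'] using hl
  · intro l hl
    field_simp
  · intro l hl
    field_simp
  · intro l _
    rfl

end ZeroSums

/-! ### Frequencies of the values of traces and zero sums. -/

section Distributions

/-- The sum over one column of the code of a function that only distinguishes `c = 0`. -/
theorem sum_ite_zero {K : Type*} [Field K] [Fintype K] (G : ℂ → ℂ) (a b : ℂ) :
    ∑ c : K, G (if c = 0 then a else b) = G a + ((Fintype.card K : ℂ) - 1) * G b := by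
  rw [sum_eq_apply_zero_add, if_pos rfl, Finset.sum_congr rfl (g := fun _ => G b)
    (fun c hc => by rw [if_neg (Finset.mem_filter.mp hc).2]), Finset.sum_const, nsmul_eq_mul,
    Finset.filter_ne', Finset.card_erase_of_mem (Finset.mem_univ _), Finset.card_univ,
    Nat.cast_sub Fintype.card_pos, Nat.cast_one]

theorem sum_comp_eq_sum_card {A B : Type*} [Fintype A] [Fintype B] (f : A → B) (Φ : B → ℂ) :
    ∑ a, Φ (f a) = ∑ b, ((Finset.univ.filter fun a => f a = b).card : ℂ) * Φ b := by
  rw [← Finset.sum_fiberwise_of_maps_to (g := f) (t := Finset.univ)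
    (fun _ _ => Finset.mem_univ _)]
  refine Finset.sum_congr rfl fun b _ => ?_
  rw [Finset.sum_congr rfl (g := fun _ => Φ b)
    (fun x hx => by rw [(Finset.mem_filter.mp hx).2]), Finset.sum_const, nsmul_eq_mul]

section Plane

variable {K F : Type*} [Field K] [Fintype K] [Field F] [Fintype F] [Algebra K F]
  {ψ : AddChar F ℂ} {ψK : AddChar K ℂ}

theorem card_ne_zero_cast : (Fintype.card K : ℂ) ≠ 0 := Nat.cast_ne_zero.mpr Fintype.card_ne_zero

/-- Summation over the nonzero points of the plane of a function of the relative trace of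
`x² + y²`. -/
theorem sum_trace_plane (hF : ringChar F ≠ 2) (hψ : ψ.IsPrimitive) (hψK : ψK.IsPrimitive)
    (hK : ∀ z, ψ z = ψK (Algebra.trace K F z)) (Φ : K → ℂ) :
    ∑ u : F × F with u ≠ 0, Φ (Algebra.trace K F (u.1 ^ 2 + u.2 ^ 2)) =
      (((Fintype.card F : ℂ) ^ 2 + ((Fintype.card K : ℂ) - 1) *
        (complexQuadraticChar F (-1) * Fintype.card F)) / Fintype.card K - 1) * Φ 0 +
      ((Fintype.card F : ℂ) ^ 2 - complexQuadraticChar F (-1) * Fintype.card F) /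
        Fintype.card K * ∑ t : K with t ≠ 0, Φ t := by
  have h := sum_comp_eq_sum_card
    (fun u : F × F => Algebra.trace K F (u.1 ^ 2 + u.2 ^ 2)) Φ
  rw [sum_eq_apply_zero_add] at h
  rw [sum_eq_apply_zero_add (M := K)] at h
  simp only [Prod.fst_zero, Prod.snd_zero, ne_eq, OfNat.ofNat_ne_zero, not_false_eq_true, zero_pow,
    add_zero, map_zero] at h
  have hcard := fun t => card_trace_plane hF hψ hψK hK t
  have h0 := card_ne_zero_cast (K := K)
  have hcard' : ∀ t : K, ((Finset.univ.filter fun v : F × F =>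
      Algebra.trace K F (v.1 ^ 2 + v.2 ^ 2) = t).card : ℂ) =
      ((Fintype.card F : ℂ) ^ 2 + complexQuadraticChar F (-1) * Fintype.card F *
        ((if t = 0 then (Fintype.card K : ℂ) else 0) - 1)) / Fintype.card K := by
    intro t
    rw [← hcard t, mul_div_cancel_left₀ _ h0]
  have hsum : ∑ t : K with ¬ t = 0, ((Finset.univ.filter fun v : F × F =>
      Algebra.trace K F (v.1 ^ 2 + v.2 ^ 2) = t).card : ℂ) * Φ t =
      ((Fintype.card F : ℂ) ^ 2 - complexQuadraticChar F (-1) * Fintype.card F) /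
        Fintype.card K * ∑ t : K with t ≠ 0, Φ t := by
    rw [Finset.mul_sum]
    refine Finset.sum_congr rfl fun t ht => ?_
    rw [hcard', if_neg (Finset.mem_filter.mp ht).2]
    ring
  rw [hsum, hcard', if_pos rfl] at h
  linear_combination h

theorem sum_trace_plane_ite (hF : ringChar F ≠ 2) (hψ : ψ.IsPrimitive)
    (hψK : ψK.IsPrimitive) (hK : ∀ z, ψ z = ψK (Algebra.trace K F z)) (a b : ℂ) :
    ∑ u : F × F with u ≠ 0, (if Algebra.trace K F (u.1 ^ 2 + u.2 ^ 2) = 0 then a else b) =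
      (((Fintype.card F : ℂ) ^ 2 + ((Fintype.card K : ℂ) - 1) *
        (complexQuadraticChar F (-1) * Fintype.card F)) / Fintype.card K - 1) * a +
      ((Fintype.card F : ℂ) ^ 2 - complexQuadraticChar F (-1) * Fintype.card F) /
        Fintype.card K * (((Fintype.card K : ℂ) - 1) * b) := by
  rw [sum_trace_plane hF hψ hψK hK fun t => if t = 0 then a else b, if_pos rfl]
  congr 2
  have := sum_ite_zero (K := K) id a b
  rw [sum_eq_apply_zero_add] at this
  simpa using this

end Plane

/-! ### The distribution of Tr(c²/R) and the incomplete Gauss sums over the base field. -/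

section Tower

variable {K L : Type*} [Field K] [Fintype K] [Field L] [Fintype L] [Algebra K L]
  {ψK : AddChar K ℂ} {ψL : AddChar L ℂ}

/-- The distribution of the trace of `c² / R`. -/
theorem card_trace_sq_div (hL : ringChar L ≠ 2) (hψK : ψK.IsPrimitive) (hψL : ψL.IsPrimitive)
    (h : ∀ z, ψL z = ψK (Algebra.trace K L z)) {R : L} (hR : R ≠ 0) (t : K) :
    (Fintype.card K : ℂ) *
        (Finset.univ.filter fun c : L => Algebra.trace K L (c ^ 2 / R) = t).card =
      Fintype.card L + complexQuadraticChar L R * quadraticGaussSum ψL *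
        ∑ l : K with l ≠ 0, complexQuadraticChar L (algebraMap K L l) * ψK (-(l * t)) := by
  have key : ∑ c : L, ∑ l : K, ψL (algebraMap K L l * (c ^ 2 / R)) * ψK (l * -t) =
      (Fintype.card K : ℂ) *
        (Finset.univ.filter fun c : L => Algebra.trace K L (c ^ 2 / R) = t).card := by
    simp only [← sum_addChar_mul_trace h, sum_addChar_mul hψK]
    rw [← Finset.sum_filter, Finset.sum_const, nsmul_eq_mul, mul_comm]
    simp only [← sub_eq_add_neg, sub_eq_zero]
  rw [← key, Finset.sum_comm, sum_eq_apply_zero_add]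
  congr 1
  · simp
  · rw [Finset.mul_sum]
    refine Finset.sum_congr rfl fun l hl => ?_
    have hl' : algebraMap K L l ≠ 0 := by simpa using (Finset.mem_filter.mp hl).2
    rw [← Finset.sum_mul]
    have := sum_addChar_mul_sq hL hψL (mul_ne_zero hl' (inv_ne_zero hR))
    rw [map_mul, complexQuadraticChar_inv] at this
    rw [mul_neg, ← mul_assoc, mul_comm (complexQuadraticChar L R * _), ← mul_assoc, ← this]
    congr 1
    refine Finset.sum_congr rfl fun c _ => ?_
    congr 1
    ring

theorem sum_trace_sq_div (hL : ringChar L ≠ 2) (hψK : ψK.IsPrimitive) (hψL : ψL.IsPrimitive)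
    (h : ∀ z, ψL z = ψK (Algebra.trace K L z)) {R : L} (hR : R ≠ 0) (Φ : K → ℂ) :
    ∑ c : L, Φ (Algebra.trace K L (c ^ 2 / R)) =
      ∑ t : K, (Fintype.card L + complexQuadraticChar L R * quadraticGaussSum ψL *
        ∑ l : K with l ≠ 0, complexQuadraticChar L (algebraMap K L l) * ψK (-(l * t))) /
          Fintype.card K * Φ t := by
  rw [sum_comp_eq_sum_card (fun c : L => Algebra.trace K L (c ^ 2 / R)) Φ]
  refine Finset.sum_congr rfl fun t _ => ?_
  rw [← card_trace_sq_div hL hψK hψL h hR, mul_div_cancel_left₀ _ card_ne_zero_cast]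

/-- The incomplete Gauss sum over the base field of an extension of even degree. -/
theorem sum_quadraticChar_even (hK : ringChar K ≠ 2) (hψK : ψK.IsPrimitive) {r : ℕ}
    (hr : Even r) (hcard : Fintype.card L = Fintype.card K ^ r) (t : K) :
    ∑ l : K with l ≠ 0, complexQuadraticChar L (algebraMap K L l) * ψK (-(l * t)) =
      (if t = 0 then (Fintype.card K : ℂ) else 0) - 1 := by
  have := sum_ne_zero_addChar_mul hψK (-t)
  simp only [neg_eq_zero] at this
  rw [← this]
  refine Finset.sum_congr rfl fun l hl => ?_
  obtain ⟨k, rfl⟩ := hr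
  rw [complexQuadraticChar_apply, quadraticChar_algebraMap hK hcard (Finset.mem_filter.mp hl).2,
    ← two_mul, pow_mul, quadraticChar_sq_one (Finset.mem_filter.mp hl).2]
  simp

/-- The incomplete Gauss sum over the base field of an extension of odd degree. -/
theorem sum_quadraticChar_odd (hK : ringChar K ≠ 2) {r : ℕ}
    (hr : Odd r) (hcard : Fintype.card L = Fintype.card K ^ r) (t : K) :
    ∑ l : K with l ≠ 0, complexQuadraticChar L (algebraMap K L l) * ψK (-(l * t)) =
      complexQuadraticChar K (-1) * complexQuadraticChar K t * quadraticGaussSum ψK := by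
  have h := sum_quadraticChar_mul_addChar (ψ := ψK) (-t) hK
  rw [sum_eq_apply_zero_add, MulChar.map_zero, zero_mul, zero_add, ← neg_one_mul t, map_mul] at h
  rw [← h]
  refine Finset.sum_congr rfl fun l hl => ?_
  obtain ⟨k, rfl⟩ := hr
  rw [complexQuadraticChar_apply, quadraticChar_algebraMap hK hcard (Finset.mem_filter.mp hl).2,
    pow_succ, pow_mul, quadraticChar_sq_one (Finset.mem_filter.mp hl).2, one_pow, one_mul,
    complexQuadraticChar_apply]
  simp

end Tower

/-! ### Summing an arbitrary function of the zero sum over all (u, c) with u ≠ 0. -/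

section ZeroSumDistributions

variable {K₁ K₂ F : Type*} [Field K₁] [Fintype K₁] [Field K₂] [Fintype K₂] [Field F] [Fintype F]
  [Algebra K₁ F] [Algebra K₂ F]
  {ψ : AddChar F ℂ} {ψ₁ : AddChar K₁ ℂ} {ψ₂ : AddChar K₂ ℂ}

/-- The distribution of the zero sums when `K₂ ⊆ K₁`. -/
theorem sum_zeroSum_of_le [Algebra K₂ K₁] [IsScalarTower K₂ K₁ F] (hF : ringChar F ≠ 2)
    (hψ : ψ.IsPrimitive) (hψ₁ : ψ₁.IsPrimitive) (hψ₂ : ψ₂.IsPrimitive)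
    (h₁ : ∀ z, ψ z = ψ₁ (Algebra.trace K₁ F z)) (G : ℂ → ℂ) :
    ∑ u : F × F with u ≠ 0, ∑ c : K₂, G (zeroSum K₁ ψ ψ₂ (u.1 ^ 2 + u.2 ^ 2) c) =
      (((Fintype.card F : ℂ) ^ 2 + ((Fintype.card K₁ : ℂ) - 1) *
        (complexQuadraticChar F (-1) * Fintype.card F)) / Fintype.card K₁ - 1) *
          (G (((Fintype.card K₁ : ℂ) - 1) * Fintype.card K₂) +
            ((Fintype.card K₂ : ℂ) - 1) * G 0) +
      ((Fintype.card F : ℂ) ^ 2 - complexQuadraticChar F (-1) * Fintype.card F) /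
        Fintype.card K₁ * (((Fintype.card K₁ : ℂ) - 1) *
          (G ((Fintype.card K₁ : ℂ) - Fintype.card K₂) +
            ((Fintype.card K₂ : ℂ) - 1) * G (Fintype.card K₁))) := by
  rw [← sum_trace_plane_ite hF hψ hψ₁ h₁]
  refine Finset.sum_congr rfl fun u _ => ?_
  simp only [zeroSum_of_le hψ₁ hψ₂ h₁]
  split_ifs with h
  · rw [← sum_ite_zero]
    refine Finset.sum_congr rfl fun c _ => ?_
    congr 1
    split_ifs <;> simp
  · rw [← sum_ite_zero]
    refine Finset.sum_congr rfl fun c _ => ?_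
    congr 1
    split_ifs <;> simp

variable [Algebra K₁ K₂] [IsScalarTower K₁ K₂ F]

/-- The distribution of the zero sums when `K₁ ⊆ K₂` with odd degree. -/
theorem sum_zeroSum_of_odd (hF : ringChar F ≠ 2) (hK₁ : ringChar K₁ ≠ 2) (hK₂ : ringChar K₂ ≠ 2)
    (hψ : ψ.IsPrimitive) (hψ₁ : ψ₁.IsPrimitive) (hψ₂ : ψ₂.IsPrimitive)
    (h₂ : ∀ z, ψ z = ψ₂ (Algebra.trace K₂ F z))
    (h₁₂ : ∀ z, ψ₂ z = ψ₁ (Algebra.trace K₁ K₂ z)) {r : ℕ} (hr : Odd r)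
    (hcard : Fintype.card K₂ = Fintype.card K₁ ^ r) (G : ℂ → ℂ) {γ : ℂ}
    (hγ : γ = complexQuadraticChar K₁ (-1) * quadraticGaussSum ψ₁ * quadraticGaussSum ψ₂) :
    ∑ u : F × F with u ≠ 0, ∑ c : K₂, G (zeroSum K₁ ψ ψ₂ (u.1 ^ 2 + u.2 ^ 2) c) =
      (((Fintype.card F : ℂ) ^ 2 + ((Fintype.card K₂ : ℂ) - 1) *
        (complexQuadraticChar F (-1) * Fintype.card F)) / Fintype.card K₂ - 1) *
          (G (((Fintype.card K₁ : ℂ) - 1) * Fintype.card K₂) +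
            ((Fintype.card K₂ : ℂ) - 1) * G 0) +
      ((Fintype.card F : ℂ) ^ 2 - complexQuadraticChar F (-1) * Fintype.card F) /
        Fintype.card K₂ * (((Fintype.card K₂ : ℂ) - 1) *
          ((Fintype.card K₂ : ℂ) / Fintype.card K₁ * G 0 +
            ((Fintype.card K₁ : ℂ) - 1) / 2 *
              ((Fintype.card K₂ + γ) / Fintype.card K₁ * G γ +
                (Fintype.card K₂ - γ) / Fintype.card K₁ * G (-γ)))) := by
  rw [← sum_trace_plane_ite hF hψ hψ₂ h₂]
  refine Finset.sum_congr rfl fun u _ => ?_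
  split_ifs with h
  · simp only [zeroSum_of_trace_eq_zero hψ₂ h₂ h]
    rw [← sum_ite_zero]
    refine Finset.sum_congr rfl fun c _ => ?_
    congr 1
    split_ifs <;> simp
  · simp only [zeroSum_of_trace_ne_zero hK₂ hψ₂ h₂ h₁₂ h, sum_quadraticChar_odd hK₁ hr hcard]
    set R := Algebra.trace K₂ F (u.1 ^ 2 + u.2 ^ 2)
    rw [sum_trace_sq_div hK₂ hψ₁ hψ₂ h₁₂ h fun t => G (complexQuadraticChar K₂ R *
      quadraticGaussSum ψ₂ * (complexQuadraticChar K₁ (-1) * complexQuadraticChar K₁ t *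
        quadraticGaussSum ψ₁))]
    simp only [sum_quadraticChar_odd hK₁ hr hcard]
    rw [sum_eq_apply_zero_add]
    congr 1
    · rw [MulChar.map_zero, mul_zero, zero_mul, mul_zero, add_zero]
    · have := sum_ne_zero_quadraticChar hK₁ fun e =>
        (Fintype.card K₂ + complexQuadraticChar K₂ R * quadraticGaussSum ψ₂ *
          (complexQuadraticChar K₁ (-1) * e * quadraticGaussSum ψ₁)) / (Fintype.card K₁ : ℂ) *
        G (complexQuadraticChar K₂ R * quadraticGaussSum ψ₂ *
          (complexQuadraticChar K₁ (-1) * e * quadraticGaussSum ψ₁))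
      rw [this]
      congr 1
      have e1 : quadraticGaussSum ψ₂ * (complexQuadraticChar K₁ (-1) * quadraticGaussSum ψ₁) = γ := by
        rw [hγ]; ring
      -- The sign η₂(R) only exchanges the contributions of square and nonsquare t, so the sum over
      -- c is the same for every R ≠ 0.
      rcases complexQuadraticChar_eq_or h with h | h <;> rw [h]
      · simp only [one_mul, mul_one, mul_neg, neg_mul, e1, ← sub_eq_add_neg]
      · simp only [one_mul, mul_one, mul_neg, neg_mul, e1, ← sub_eq_add_neg, neg_neg]
        ring

/-- The distribution of the zero sums when `K₁ ⊆ K₂` with even degree. -/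
theorem sum_zeroSum_of_even (hF : ringChar F ≠ 2) (hK₁ : ringChar K₁ ≠ 2) (hK₂ : ringChar K₂ ≠ 2)
    (hψ : ψ.IsPrimitive) (hψ₁ : ψ₁.IsPrimitive) (hψ₂ : ψ₂.IsPrimitive)
    (h₂ : ∀ z, ψ z = ψ₂ (Algebra.trace K₂ F z))
    (h₁₂ : ∀ z, ψ₂ z = ψ₁ (Algebra.trace K₁ K₂ z)) {r : ℕ} (hr : Even r)
    (hcard : Fintype.card K₂ = Fintype.card K₁ ^ r) (G : ℂ → ℂ) {γ : ℂ}
    (hγ : γ = quadraticGaussSum ψ₂) :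
    ∑ u : F × F with u ≠ 0, ∑ c : K₂, G (zeroSum K₁ ψ ψ₂ (u.1 ^ 2 + u.2 ^ 2) c) =
      (((Fintype.card F : ℂ) ^ 2 + ((Fintype.card K₂ : ℂ) - 1) *
        (complexQuadraticChar F (-1) * Fintype.card F)) / Fintype.card K₂ - 1) *
          (G (((Fintype.card K₁ : ℂ) - 1) * Fintype.card K₂) +
            ((Fintype.card K₂ : ℂ) - 1) * G 0) +
      ((Fintype.card F : ℂ) ^ 2 - complexQuadraticChar F (-1) * Fintype.card F) /
        Fintype.card K₂ * (((Fintype.card K₂ : ℂ) - 1) / 2 *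
          (((Fintype.card K₂ + ((Fintype.card K₁ : ℂ) - 1) * γ) / Fintype.card K₁ *
              G (((Fintype.card K₁ : ℂ) - 1) * γ) +
            ((Fintype.card K₁ : ℂ) - 1) * ((Fintype.card K₂ - γ) / Fintype.card K₁ * G (-γ))) +
          ((Fintype.card K₂ - ((Fintype.card K₁ : ℂ) - 1) * γ) / Fintype.card K₁ *
              G (-(((Fintype.card K₁ : ℂ) - 1) * γ)) +
            ((Fintype.card K₁ : ℂ) - 1) * ((Fintype.card K₂ + γ) / Fintype.card K₁ * G γ)))) := by
  have hR : ∀ R : K₂, R ≠ 0 → ∑ c : K₂, G (complexQuadraticChar K₂ R * γ *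
      ((if Algebra.trace K₁ K₂ (c ^ 2 / R) = 0 then (Fintype.card K₁ : ℂ) else 0) - 1)) =
      (Fintype.card K₂ + complexQuadraticChar K₂ R * γ * ((Fintype.card K₁ : ℂ) - 1)) /
          Fintype.card K₁ * G (complexQuadraticChar K₂ R * γ * ((Fintype.card K₁ : ℂ) - 1)) +
        ((Fintype.card K₁ : ℂ) - 1) * ((Fintype.card K₂ - complexQuadraticChar K₂ R * γ) /
          Fintype.card K₁ * G (-(complexQuadraticChar K₂ R * γ))) := by
    intro R h
    rw [sum_trace_sq_div hK₂ hψ₁ hψ₂ h₁₂ h fun t => G (complexQuadraticChar K₂ R * γ *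
      ((if t = 0 then (Fintype.card K₁ : ℂ) else 0) - 1))]
    simp only [sum_quadraticChar_even hK₁ hψ₁ hr hcard, ← hγ]
    have := sum_ite_zero (K := K₁) (fun a => (Fintype.card K₂ + complexQuadraticChar K₂ R * γ *
      (a - 1)) / Fintype.card K₁ * G (complexQuadraticChar K₂ R * γ * (a - 1)))
      (Fintype.card K₁ : ℂ) 0
    rw [this]
    congr 3
    · ring
    · congr 1
      ring
  -- Unlike for odd degree, the sum over c depends on η₂(R), so R must be kept and then averaged
  -- over squares and nonsquares.
  have := sum_trace_plane hF hψ hψ₂ h₂ fun R => if R = 0 then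
    (G (((Fintype.card K₁ : ℂ) - 1) * Fintype.card K₂) + ((Fintype.card K₂ : ℂ) - 1) * G 0) else
    ∑ c : K₂, G (complexQuadraticChar K₂ R * γ *
      ((if Algebra.trace K₁ K₂ (c ^ 2 / R) = 0 then (Fintype.card K₁ : ℂ) else 0) - 1))
  rw [if_pos rfl] at this
  refine Eq.trans ?_ (this.trans ?_)
  · refine Finset.sum_congr rfl fun u _ => ?_
    split_ifs with h
    · simp only [zeroSum_of_trace_eq_zero hψ₂ h₂ h]
      rw [← sum_ite_zero]
      refine Finset.sum_congr rfl fun c _ => ?_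
      congr 1
      split_ifs <;> simp
    · simp only [zeroSum_of_trace_ne_zero hK₂ hψ₂ h₂ h₁₂ h,
        sum_quadraticChar_even hK₁ hψ₁ hr hcard, hγ]
  · congr 2
    have := sum_ne_zero_quadraticChar hK₂ fun e =>
      (Fintype.card K₂ + e * γ * ((Fintype.card K₁ : ℂ) - 1)) /
          Fintype.card K₁ * G (e * γ * ((Fintype.card K₁ : ℂ) - 1)) +
        ((Fintype.card K₁ : ℂ) - 1) * ((Fintype.card K₂ - e * γ) /
          Fintype.card K₁ * G (-(e * γ)))
    refine Eq.trans ?_ (this.trans ?_)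
    · refine Finset.sum_congr rfl fun R hR' => ?_
      rw [if_neg (Finset.mem_filter.mp hR').2, hR R (Finset.mem_filter.mp hR').2]
    simp only [one_mul, neg_mul, neg_neg, sub_neg_eq_add, ← sub_eq_add_neg,
      mul_comm γ ((Fintype.card K₁ : ℂ) - 1)]

end ZeroSumDistributions

end Distributions

/-! ### The encoding map, weights of codewords and the weight enumerator. -/

section Code

variable (K₁ K₂ F : Type*) [Field K₁] [Field K₂] [Field F] [Fintype F]
  [Algebra K₁ F] [Algebra K₂ F]

/-- The encoding map `(a, b, c) ↦ (Tr (a x + b y) + c)` of the code. -/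
noncomputable def encode : ((F × F) × K₂) →ₗ[K₂] (definingSet K₁ F → K₂) where
  toFun x v := Algebra.trace K₂ F (x.1.1 * v.1.1 + x.1.2 * v.1.2) + x.2
  map_add' x y := by
    ext v
    simp only [Prod.fst_add, Prod.snd_add, Pi.add_apply, add_mul, map_add]
    ring
  map_smul' r x := by
    ext v
    simp only [Prod.smul_fst, Prod.smul_snd, Pi.smul_apply, smul_mul_assoc, map_add, map_smul,
      smul_eq_mul, RingHom.id_apply]
    ring

variable {K₁ K₂ F}

theorem encode_apply (x : (F × F) × K₂) (v : definingSet K₁ F) :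
    encode K₁ K₂ F x v = Algebra.trace K₂ F (x.1.1 * v.1.1 + x.1.2 * v.1.2) + x.2 := rfl

theorem range_encode : LinearMap.range (encode K₁ K₂ F) = codeCD K₁ K₂ F := by
  ext w
  constructor
  · rintro ⟨⟨⟨a, b⟩, c⟩, rfl⟩
    exact ⟨a, b, c, rfl⟩
  · rintro ⟨a, b, c, rfl⟩
    exact ⟨((a, b), c), rfl⟩

theorem mem_codeCD_iff {w : definingSet K₁ F → K₂} :
    w ∈ codeCD K₁ K₂ F ↔ ∃ x, encode K₁ K₂ F x = w := by
  rw [← range_encode, LinearMap.mem_range]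

theorem zero_mem_definingSet : (0 : F × F) ∈ definingSet K₁ F := by
  simp [definingSet]

theorem mem_definingSet {v : F × F} :
    v ∈ definingSet K₁ F ↔ Algebra.trace K₁ F (v.1 ^ 2 + v.2 ^ 2) = 0 := by
  simp [definingSet]

theorem hammingNorm_encode_add (x : (F × F) × K₂) :
    hammingNorm (encode K₁ K₂ F x) + ((definingSet K₁ F).filter fun v =>
      Algebra.trace K₂ F (x.1.1 * v.1 + x.1.2 * v.2) + x.2 = 0).card =
      (definingSet K₁ F).card := by
  have h : ((definingSet K₁ F).filter fun v =>
      ¬ Algebra.trace K₂ F (x.1.1 * v.1 + x.1.2 * v.2) + x.2 = 0).card =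
      hammingNorm (encode K₁ K₂ F x) := by
    rw [hammingNorm]
    refine Finset.card_bij' (fun v hv => ⟨v, (Finset.mem_filter.mp hv).1⟩) (fun v _ => v.1)
      ?_ ?_ ?_ ?_
    · intro v hv
      simpa [encode_apply] using (Finset.mem_filter.mp hv).2
    · intro v hv
      refine Finset.mem_filter.mpr ⟨v.2, ?_⟩
      simpa [encode_apply] using hv
    · intro v hv
      rfl
    · intro v hv
      rfl
  rw [← h, add_comm, Finset.card_filter_add_card_filter_not]

theorem encode_zero_zero : encode K₁ K₂ F (0, 0) = 0 := by
  rw [← Prod.zero_eq_mk, map_zero]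

theorem hammingNorm_encode_zero {c : K₂} (hc : c ≠ 0) :
    hammingNorm (encode K₁ K₂ F (0, c)) = (definingSet K₁ F).card := by
  rw [← hammingNorm_encode_add ((0, c) : (F × F) × K₂)]
  simp [hc]

theorem finrank_codeCD (h : Function.Injective (encode K₁ K₂ F)) :
    Module.finrank K₂ (codeCD K₁ K₂ F) = 2 * Module.finrank K₂ F + 1 := by
  have : Module.Finite K₂ F := Module.Finite.of_finite
  rw [← range_encode, LinearMap.finrank_range_of_inj h, Module.finrank_prod, Module.finrank_prod,
    Module.finrank_self]
  ring

theorem weightCount_codeCD [Fintype K₂] (h : Function.Injective (encode K₁ K₂ F)) (w : ℕ) :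
    (weightCount (codeCD K₁ K₂ F) w : ℂ) = ∑ x : (F × F) × K₂,
      if (hammingNorm (encode K₁ K₂ F x) : ℂ) = w then (1 : ℂ) else 0 := by
  have hb : Nat.card {x : (F × F) × K₂ // hammingNorm (encode K₁ K₂ F x) = w} =
      weightCount (codeCD K₁ K₂ F) w := by
    refine Nat.card_eq_of_bijective
      (fun x => ⟨encode K₁ K₂ F x.1, mem_codeCD_iff.mpr ⟨x.1, rfl⟩, x.2⟩) ⟨?_, ?_⟩
    · intro x y hxy
      exact Subtype.ext (h (congrArg Subtype.val hxy))
    · rintro ⟨c, hc, hw⟩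
      obtain ⟨x, rfl⟩ := mem_codeCD_iff.mp hc
      exact ⟨⟨x, hw⟩, rfl⟩
  rw [← hb, Nat.card_eq_fintype_card, Fintype.card_subtype]
  simp only [Nat.cast_inj, Finset.sum_boole]

variable [Fintype K₁] [Fintype K₂] {ψ : AddChar F ℂ} {ψ₁ : AddChar K₁ ℂ} {ψ₂ : AddChar K₂ ℂ}

theorem card_definingSet (hF : ringChar F ≠ 2) (hψ : ψ.IsPrimitive) (hψ₁ : ψ₁.IsPrimitive)
    (h₁ : ∀ z, ψ z = ψ₁ (Algebra.trace K₁ F z)) :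
    ((definingSet K₁ F).card : ℂ) = ((Fintype.card F : ℂ) ^ 2 + ((Fintype.card K₁ : ℂ) - 1) *
      (complexQuadraticChar F (-1) * Fintype.card F)) / Fintype.card K₁ := by
  rw [eq_div_iff card_ne_zero_cast, mul_comm, definingSet, card_trace_plane hF hψ hψ₁ h₁ 0,
    if_pos rfl]
  ring

theorem hammingNorm_encode (hF : ringChar F ≠ 2) (hK₁ : ringChar K₁ ≠ 2)
    (hψ : ψ.IsPrimitive) (hψ₁ : ψ₁.IsPrimitive) (hψ₂ : ψ₂.IsPrimitive)
    (h₁ : ∀ z, ψ z = ψ₁ (Algebra.trace K₁ F z)) (h₂ : ∀ z, ψ z = ψ₂ (Algebra.trace K₂ F z))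
    {u : F × F} (hu : u ≠ 0) (c : K₂) :
    (hammingNorm (encode K₁ K₂ F (u, c)) : ℂ) = (definingSet K₁ F).card -
      ((Fintype.card F : ℂ) ^ 2 + complexQuadraticChar F (-1) * Fintype.card F *
        zeroSum K₁ ψ ψ₂ (u.1 ^ 2 + u.2 ^ 2) c) / (Fintype.card K₁ * Fintype.card K₂) := by
  rw [← card_zeros hF hK₁ hψ hψ₁ hψ₂ h₁ h₂ hu c, mul_div_cancel_left₀ _
    (mul_ne_zero card_ne_zero_cast card_ne_zero_cast), ← hammingNorm_encode_add ((u, c) : (F × F) × K₂)]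
  push_cast
  ring

/-- Outside the degenerate case in which the quadric is a point, encoding is injective. -/
theorem encode_injective (hF : ringChar F ≠ 2) (hK₁ : ringChar K₁ ≠ 2)
    (hψ : ψ.IsPrimitive) (hψ₁ : ψ₁.IsPrimitive) (hψ₂ : ψ₂.IsPrimitive)
    (h₁ : ∀ z, ψ z = ψ₁ (Algebra.trace K₁ F z)) (h₂ : ∀ z, ψ z = ψ₂ (Algebra.trace K₂ F z))
    (hD : ¬ (Fintype.card K₁ = Fintype.card F ∧ complexQuadraticChar F (-1) = -1)) :
    Function.Injective (encode K₁ K₂ F) := by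
  rw [injective_iff_map_eq_zero]
  rintro ⟨u, c⟩ h
  have hc : c = 0 := by
    have := congrFun h ⟨0, zero_mem_definingSet⟩
    simpa [encode_apply] using this
  subst hc
  by_contra hne
  have hu : u ≠ 0 := by
    rintro rfl
    exact hne rfl
  have hw := hammingNorm_encode hF hK₁ hψ hψ₁ hψ₂ h₁ h₂ hu 0
  rw [h, hammingNorm_zero, card_definingSet hF hψ hψ₁ h₁, zeroSum_zero hψ₁ h₁] at hw
  set S := Finset.univ.filter fun m : K₂ =>
    Algebra.trace K₁ F (algebraMap K₂ F m ^ 2 * (u.1 ^ 2 + u.2 ^ 2)) = 0 with hS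
  have hS0 : 0 < S.card := Finset.card_pos.mpr ⟨0, by simp [hS]⟩
  have hS1 : S.card ≤ Fintype.card K₂ := Finset.card_le_univ _
  have hq1 := card_ne_zero_cast (K := K₁)
  have hq2 := card_ne_zero_cast (K := K₂)
  have hq := card_ne_zero_cast (K := F)
  have h2 : 1 < Fintype.card K₂ := Fintype.one_lt_card
  have hle : Fintype.card K₁ ≤ Fintype.card F :=
    Fintype.card_le_of_injective _ (algebraMap K₁ F).injective
  -- If η(-1) = 1, the right side is at most 0 while the left is positive. If η(-1) = -1, then |S| ≥
  -- 1 (it contains m = 0) forces |F| ≤ |K₁|, the excluded case.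
  have heq : ((Fintype.card K₂ : ℂ) - 1) * Fintype.card F =
      complexQuadraticChar F (-1) * (Fintype.card K₁ * (S.card - Fintype.card K₂)) := by
    field_simp at hw
    have hw' : (Fintype.card F : ℂ) * (((Fintype.card K₂ : ℂ) - 1) * Fintype.card F -
      complexQuadraticChar F (-1) * (Fintype.card K₁ * (S.card - Fintype.card K₂))) = 0 := by
      linear_combination -hw
    exact sub_eq_zero.mp ((mul_eq_zero.mp hw').resolve_left hq)
  have h10 : 0 < Fintype.card K₁ := Fintype.card_pos
  have hF0 : 0 < Fintype.card F := Fintype.card_pos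
  rcases complexQuadraticChar_eq_or (neg_ne_zero.mpr (one_ne_zero (α := F))) with he | he
  · rw [he] at heq
    have heqZ : ((Fintype.card K₂ : ℤ) - 1) * Fintype.card F =
        Fintype.card K₁ * (S.card - Fintype.card K₂) := by
      have : (((Fintype.card K₂ : ℤ) - 1) * Fintype.card F : ℂ) =
        ((Fintype.card K₁ * (S.card - Fintype.card K₂) : ℤ) : ℂ) := by
        push_cast
        linear_combination heq
      exact_mod_cast this
    zify at *
    nlinarith
  · rw [he] at heq
    have heqZ : ((Fintype.card K₂ : ℤ) - 1) * Fintype.card F =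
        Fintype.card K₁ * (Fintype.card K₂ - S.card) := by
      have : (((Fintype.card K₂ : ℤ) - 1) * Fintype.card F : ℂ) =
        ((Fintype.card K₁ * (Fintype.card K₂ - S.card) : ℤ) : ℂ) := by
        push_cast
        linear_combination heq
      exact_mod_cast this
    have hlt : Fintype.card K₁ < Fintype.card F := lt_of_le_of_ne hle fun h => hD ⟨h, he⟩
    zify at *
    nlinarith

/-- The weight enumerator of the code in terms of the zero sums. -/
theorem weightCount_eq_sum_zeroSum (hF : ringChar F ≠ 2) (hK₁ : ringChar K₁ ≠ 2)
    (hψ : ψ.IsPrimitive) (hψ₁ : ψ₁.IsPrimitive) (hψ₂ : ψ₂.IsPrimitive)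
    (h₁ : ∀ z, ψ z = ψ₁ (Algebra.trace K₁ F z)) (h₂ : ∀ z, ψ z = ψ₂ (Algebra.trace K₂ F z))
    (h : Function.Injective (encode K₁ K₂ F)) (w : ℕ) {g : ℂ → ℂ}
    (hg : g = fun z => if z = (w : ℂ) then (1 : ℂ) else 0) :
    (weightCount (codeCD K₁ K₂ F) w : ℂ) =
      g 0 + ((Fintype.card K₂ : ℂ) - 1) * g (definingSet K₁ F).card +
      ∑ u : F × F with u ≠ 0, ∑ c : K₂, g ((definingSet K₁ F).card -
      ((Fintype.card F : ℂ) ^ 2 + complexQuadraticChar F (-1) * Fintype.card F *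
        zeroSum K₁ ψ ψ₂ (u.1 ^ 2 + u.2 ^ 2) c) / (Fintype.card K₁ * Fintype.card K₂)) := by
  have hsum : (weightCount (codeCD K₁ K₂ F) w : ℂ) =
      ∑ u : F × F, ∑ c : K₂, g (hammingNorm (encode K₁ K₂ F (u, c))) := by
    rw [weightCount_codeCD h, Fintype.sum_prod_type, hg]
  rw [hsum, sum_eq_apply_zero_add]
  congr 1
  · rw [← sum_ite_zero]
    refine Finset.sum_congr rfl fun c _ => ?_
    split_ifs with hc
    · rw [hc, encode_zero_zero, hammingNorm_zero, Nat.cast_zero]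
    · rw [hammingNorm_encode_zero hc]
  · refine Finset.sum_congr (by ext; simp) fun u hu => Finset.sum_congr rfl fun c _ => ?_
    rw [hammingNorm_encode hF hK₁ hψ hψ₁ hψ₂ h₁ h₂ (Finset.mem_filter.mp hu).2]

end Code

/-! ### The square of the closed-form Gauss sum. -/

section GaussValues

theorem gaussValue_sq {p t : ℕ} (hp : Odd p) {K : Type*} [Field K] [Fintype K]
    (hK : ringChar K ≠ 2) (hcard : Fintype.card K = p ^ t) :
    gaussValue p t ^ 2 = complexQuadraticChar K (-1) * Fintype.card K := by
  have h1 : ((-1 : ℂ) ^ (t - 1)) ^ 2 = 1 := by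
    rw [← pow_mul, mul_comm, pow_mul, neg_one_sq, one_pow]
  have h2 : ((Real.sqrt ((p : ℝ) ^ t) : ℝ) : ℂ) ^ 2 = (p : ℂ) ^ t := by
    rw [← Complex.ofReal_pow, Real.sq_sqrt (by positivity)]
    push_cast
    rfl
  have h3 : (Complex.I ^ (((p - 1) / 2) ^ 2 * t)) ^ 2 = complexQuadraticChar K (-1) := by
    rw [← pow_mul, mul_comm, pow_mul, Complex.I_sq, complexQuadraticChar_apply,
      quadraticChar_neg_one hK, hcard]
    have hχ : ZMod.χ₄ ((p ^ t : ℕ) : ZMod 4) = ((-1) ^ (p / 2)) ^ t := by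
      rw [Nat.cast_pow, map_pow, ZMod.χ₄_eq_neg_one_pow (Nat.odd_iff.mp hp)]
    rw [hχ]
    push_cast
    have hdiv : (p - 1) / 2 = p / 2 := by
      obtain ⟨k, rfl⟩ := hp
      omega
    rw [hdiv, pow_mul, sq, pow_mul]
    congr 1
    -- The square in the exponent is harmless: k² and k have the same parity.
    rcases neg_one_pow_eq_or ℂ (p / 2) with h | h <;> rw [h]
    · simp
    · exact h
  rw [gaussValue, mul_pow, mul_pow, h1, h2, h3, hcard]
  push_cast
  ring

end GaussValues

/-! ### Each table as a linear expression in values of the indicator function. -/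

section Tables

/-- With `g` given only through an equation, its values stay atoms and the comparison of tables
becomes field arithmetic. -/
theorem sum_rows_eq (T : List (ℂ × ℂ)) {w : ℕ} {g : ℂ → ℂ}
    (hg : g = fun z => if z = (w : ℂ) then (1 : ℂ) else 0) :
    (T.map fun row => if row.1 = (w : ℂ) then row.2 else 0).sum =
      (T.map fun row => row.2 * g row.1).sum := by
  simp [hg]

variable {p s s₁ s₂ : ℕ} {q q₁ q₂ e : ℂ} {g : ℂ → ℂ} {w : ℕ}

theorem sum_weightTable₁ (hg : g = fun z => if z = (w : ℂ) then (1 : ℂ) else 0)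
    (hq : (p : ℂ) ^ s = q) (hq₁ : (p : ℂ) ^ s₁ = q₁) (hq₂ : (p : ℂ) ^ s₂ = q₂)
    (h₁ : q₁ ≠ 0) (h₂ : q₂ ≠ 0) (he : gaussValue p s ^ 2 = e) :
    ((weightTable₁ p s s₁ s₂).map fun row => if row.1 = (w : ℂ) then row.2 else 0).sum =
      g 0 + (q₂ - 1) * g ((q ^ 2 + (q₁ - 1) * e) / q₁) +
      (((q ^ 2 + (q₁ - 1) * e) / q₁ - 1) *
        (g ((q ^ 2 + (q₁ - 1) * e) / q₁ - (q ^ 2 + e * ((q₁ - 1) * q₂)) / (q₁ * q₂)) +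
          (q₂ - 1) * g ((q ^ 2 + (q₁ - 1) * e) / q₁ - (q ^ 2 + e * 0) / (q₁ * q₂))) +
      (q ^ 2 - e) / q₁ * ((q₁ - 1) *
        (g ((q ^ 2 + (q₁ - 1) * e) / q₁ - (q ^ 2 + e * (q₁ - q₂)) / (q₁ * q₂)) +
          (q₂ - 1) * g ((q ^ 2 + (q₁ - 1) * e) / q₁ - (q ^ 2 + e * q₁) / (q₁ * q₂))))) := by
  have hqq : (p : ℂ) ^ (2 * s) = q ^ 2 := by rw [mul_comm, pow_mul, hq]
  rw [sum_rows_eq _ hg]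
  simp only [weightTable₁, quadricCount, List.map_cons, List.map_nil, List.sum_cons, List.sum_nil,
    pow_add, hqq, hq₁, hq₂, he]
  have e1 : (q ^ 2 + (q₁ - 1) * e) / q₁ - (q ^ 2 + e * ((q₁ - 1) * q₂)) / (q₁ * q₂) =
      q ^ 2 * (q₂ - 1) / (q₁ * q₂) := by field_simp; ring
  have e2 : (q ^ 2 + (q₁ - 1) * e) / q₁ - (q ^ 2 + e * 0) / (q₁ * q₂) =
      q ^ 2 * (q₂ - 1) / (q₁ * q₂) + (q₁ - 1) * e / q₁ := by field_simp; ring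
  have e3 : (q ^ 2 + (q₁ - 1) * e) / q₁ - (q ^ 2 + e * (q₁ - q₂)) / (q₁ * q₂) =
      q ^ 2 * (q₂ - 1) / (q₁ * q₂) + (q₁ * q₂ - q₁) * e / (q₁ * q₂) := by field_simp; ring
  have e4 : (q ^ 2 + (q₁ - 1) * e) / q₁ - (q ^ 2 + e * q₁) / (q₁ * q₂) =
      q ^ 2 * (q₂ - 1) / (q₁ * q₂) + (q₁ * q₂ - q₁ - q₂) * e / (q₁ * q₂) := by
    field_simp; ring
  simp only [e1, e2, e3, e4]
  ring

/-- Replacing γ by -γ swaps the last two rows, so either sign is admissible. The fourth row merges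
the two sources of Z = 0: R = 0 with c ≠ 0, and R ≠ 0 with Tr(c²/R) = 0. The frequencies match
because q² - m = (q₂ - 1)(q² - e)/q₂. -/
theorem sum_weightTable₂ {e₁ e₂ γ : ℂ}
    (hg : g = fun z => if z = (w : ℂ) then (1 : ℂ) else 0)
    (hq : (p : ℂ) ^ s = q) (hq₁ : (p : ℂ) ^ s₁ = q₁) (hq₂ : (p : ℂ) ^ s₂ = q₂)
    (h₁ : q₁ ≠ 0) (h₂ : q₂ ≠ 0) (he : gaussValue p s ^ 2 = e) (he₁₂ : e₂ = e₁)
    (hγ : γ = e₁ * gaussValue p s₁ * gaussValue p s₂ ∨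
      γ = -(e₁ * gaussValue p s₁ * gaussValue p s₂)) :
    ((weightTable₂ p s s₁ s₂ e₁ e₂).map fun row => if row.1 = (w : ℂ) then row.2 else 0).sum =
      g 0 + (q₂ - 1) * g ((q ^ 2 + (q₁ - 1) * e) / q₁) +
      (((q ^ 2 + (q₂ - 1) * e) / q₂ - 1) *
        (g ((q ^ 2 + (q₁ - 1) * e) / q₁ - (q ^ 2 + e * ((q₁ - 1) * q₂)) / (q₁ * q₂)) +
          (q₂ - 1) * g ((q ^ 2 + (q₁ - 1) * e) / q₁ - (q ^ 2 + e * 0) / (q₁ * q₂))) +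
      (q ^ 2 - e) / q₂ * ((q₂ - 1) *
        (q₂ / q₁ * g ((q ^ 2 + (q₁ - 1) * e) / q₁ - (q ^ 2 + e * 0) / (q₁ * q₂)) +
          (q₁ - 1) / 2 *
            ((q₂ + γ) / q₁ * g ((q ^ 2 + (q₁ - 1) * e) / q₁ - (q ^ 2 + e * γ) / (q₁ * q₂)) +
              (q₂ - γ) / q₁ *
                g ((q ^ 2 + (q₁ - 1) * e) / q₁ - (q ^ 2 + e * -γ) / (q₁ * q₂)))))) := by
  have hqq : (p : ℂ) ^ (2 * s) = q ^ 2 := by rw [mul_comm, pow_mul, hq]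
  obtain ⟨δ, hδ⟩ : ∃ δ, δ = e₁ * gaussValue p s₁ * gaussValue p s₂ := ⟨_, rfl⟩
  rw [sum_rows_eq _ hg]
  simp only [weightTable₂, quadricCount, List.map_cons, List.map_nil, List.sum_cons, List.sum_nil,
    pow_add, hqq, hq₁, hq₂, he, he₁₂]
  rw [← hδ] at hγ ⊢
  have e1 : (q ^ 2 + (q₁ - 1) * e) / q₁ - (q ^ 2 + e * ((q₁ - 1) * q₂)) / (q₁ * q₂) =
      q ^ 2 * (q₂ - 1) / (q₁ * q₂) := by field_simp; ring
  have e2 : (q ^ 2 + (q₁ - 1) * e) / q₁ - (q ^ 2 + e * 0) / (q₁ * q₂) =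
      q ^ 2 * (q₂ - 1) / (q₁ * q₂) + (q₁ - 1) * e / q₁ := by field_simp; ring
  simp only [e1, e2]
  rcases hγ with hγ | hγ
  · rw [hγ, show q ^ 2 + e * δ = q ^ 2 + δ * e by ring,
      show q ^ 2 + e * -δ = q ^ 2 - δ * e by ring]
    generalize (q ^ 2 + (q₁ - 1) * e) / q₁ - (q ^ 2 + δ * e) / (q₁ * q₂) = X
    generalize (q ^ 2 + (q₁ - 1) * e) / q₁ - (q ^ 2 - δ * e) / (q₁ * q₂) = Y
    generalize g (q ^ 2 * (q₂ - 1) / (q₁ * q₂)) = A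
    generalize g (q ^ 2 * (q₂ - 1) / (q₁ * q₂) + (q₁ - 1) * e / q₁) = B
    generalize g ((q ^ 2 + (q₁ - 1) * e) / q₁) = C
    field_simp
    ring
  · rw [hγ, show q ^ 2 + e * -δ = q ^ 2 - δ * e by ring,
      show q ^ 2 + e * - -δ = q ^ 2 + δ * e by ring]
    generalize (q ^ 2 + (q₁ - 1) * e) / q₁ - (q ^ 2 + δ * e) / (q₁ * q₂) = X
    generalize (q ^ 2 + (q₁ - 1) * e) / q₁ - (q ^ 2 - δ * e) / (q₁ * q₂) = Y
    generalize g (q ^ 2 * (q₂ - 1) / (q₁ * q₂)) = A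
    generalize g (q ^ 2 * (q₂ - 1) / (q₁ * q₂) + (q₁ - 1) * e / q₁) = B
    generalize g ((q ^ 2 + (q₁ - 1) * e) / q₁) = C
    field_simp
    ring

/-- For even degree η''(-1) = 1, whence the last argument of the table. A change of sign of γ swaps
the last four rows in pairs. -/
theorem sum_weightTable₃ {γ : ℂ} (hg : g = fun z => if z = (w : ℂ) then (1 : ℂ) else 0)
    (hq : (p : ℂ) ^ s = q) (hq₁ : (p : ℂ) ^ s₁ = q₁) (hq₂ : (p : ℂ) ^ s₂ = q₂)
    (h₁ : q₁ ≠ 0) (h₂ : q₂ ≠ 0) (he : gaussValue p s ^ 2 = e)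
    (hγ : γ = gaussValue p s₂ ∨ γ = -gaussValue p s₂) :
    ((weightTable₃ p s s₁ s₂ 1).map fun row => if row.1 = (w : ℂ) then row.2 else 0).sum =
      g 0 + (q₂ - 1) * g ((q ^ 2 + (q₁ - 1) * e) / q₁) +
      (((q ^ 2 + (q₂ - 1) * e) / q₂ - 1) *
        (g ((q ^ 2 + (q₁ - 1) * e) / q₁ - (q ^ 2 + e * ((q₁ - 1) * q₂)) / (q₁ * q₂)) +
          (q₂ - 1) * g ((q ^ 2 + (q₁ - 1) * e) / q₁ - (q ^ 2 + e * 0) / (q₁ * q₂))) +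
      (q ^ 2 - e) / q₂ * ((q₂ - 1) / 2 *
        (((q₂ + (q₁ - 1) * γ) / q₁ *
            g ((q ^ 2 + (q₁ - 1) * e) / q₁ - (q ^ 2 + e * ((q₁ - 1) * γ)) / (q₁ * q₂)) +
          (q₁ - 1) * ((q₂ - γ) / q₁ *
            g ((q ^ 2 + (q₁ - 1) * e) / q₁ - (q ^ 2 + e * -γ) / (q₁ * q₂)))) +
        ((q₂ - (q₁ - 1) * γ) / q₁ *
            g ((q ^ 2 + (q₁ - 1) * e) / q₁ - (q ^ 2 + e * -((q₁ - 1) * γ)) / (q₁ * q₂)) +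
          (q₁ - 1) * ((q₂ + γ) / q₁ *
            g ((q ^ 2 + (q₁ - 1) * e) / q₁ - (q ^ 2 + e * γ) / (q₁ * q₂))))))) := by
  have hqq : (p : ℂ) ^ (2 * s) = q ^ 2 := by rw [mul_comm, pow_mul, hq]
  rw [sum_rows_eq _ hg]
  simp only [weightTable₃, quadricCount, List.map_cons, List.map_nil, List.sum_cons, List.sum_nil,
    pow_add, hqq, hq₁, hq₂, he, one_mul]
  generalize gaussValue p s₂ = δ at hγ ⊢
  have e1 : (q ^ 2 + (q₁ - 1) * e) / q₁ - (q ^ 2 + e * ((q₁ - 1) * q₂)) / (q₁ * q₂) =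
      q ^ 2 * (q₂ - 1) / (q₁ * q₂) := by field_simp; ring
  have e2 : (q ^ 2 + (q₁ - 1) * e) / q₁ - (q ^ 2 + e * 0) / (q₁ * q₂) =
      q ^ 2 * (q₂ - 1) / (q₁ * q₂) + (q₁ - 1) * e / q₁ := by field_simp; ring
  simp only [e1, e2]
  rcases hγ with hγ | hγ
  · rw [hγ, show q ^ 2 + e * ((q₁ - 1) * δ) = q ^ 2 + (q₁ - 1) * δ * e by ring,
      show q ^ 2 + e * -((q₁ - 1) * δ) = q ^ 2 - (q₁ - 1) * δ * e by ring,
      show q ^ 2 + e * -δ = q ^ 2 - δ * e by ring,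
      show q ^ 2 + e * δ = q ^ 2 + δ * e by ring]
    generalize (q ^ 2 + (q₁ - 1) * e) / q₁ - (q ^ 2 + (q₁ - 1) * δ * e) / (q₁ * q₂) = X
    generalize (q ^ 2 + (q₁ - 1) * e) / q₁ - (q ^ 2 - (q₁ - 1) * δ * e) / (q₁ * q₂) = Y
    generalize (q ^ 2 + (q₁ - 1) * e) / q₁ - (q ^ 2 - δ * e) / (q₁ * q₂) = Z
    generalize (q ^ 2 + (q₁ - 1) * e) / q₁ - (q ^ 2 + δ * e) / (q₁ * q₂) = W
    generalize g (q ^ 2 * (q₂ - 1) / (q₁ * q₂)) = A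
    generalize g (q ^ 2 * (q₂ - 1) / (q₁ * q₂) + (q₁ - 1) * e / q₁) = B
    generalize g ((q ^ 2 + (q₁ - 1) * e) / q₁) = C
    field_simp
    ring
  · rw [hγ, show q ^ 2 + e * ((q₁ - 1) * -δ) = q ^ 2 - (q₁ - 1) * δ * e by ring,
      show q ^ 2 + e * -((q₁ - 1) * -δ) = q ^ 2 + (q₁ - 1) * δ * e by ring,
      show q ^ 2 + e * - -δ = q ^ 2 + δ * e by ring,
      show q ^ 2 + e * -δ = q ^ 2 - δ * e by ring]
    generalize (q ^ 2 + (q₁ - 1) * e) / q₁ - (q ^ 2 + (q₁ - 1) * δ * e) / (q₁ * q₂) = X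
    generalize (q ^ 2 + (q₁ - 1) * e) / q₁ - (q ^ 2 - (q₁ - 1) * δ * e) / (q₁ * q₂) = Y
    generalize (q ^ 2 + (q₁ - 1) * e) / q₁ - (q ^ 2 - δ * e) / (q₁ * q₂) = Z
    generalize (q ^ 2 + (q₁ - 1) * e) / q₁ - (q ^ 2 + δ * e) / (q₁ * q₂) = W
    generalize g (q ^ 2 * (q₂ - 1) / (q₁ * q₂)) = A
    generalize g (q ^ 2 * (q₂ - 1) / (q₁ * q₂) + (q₁ - 1) * e / q₁) = B
    generalize g ((q ^ 2 + (q₁ - 1) * e) / q₁) = C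
    field_simp
    ring

end Tables

/-! ### Self-orthogonality by divisibility of fibres. -/

section SelfOrthogonal

variable {p : ℕ} [Fact p.Prime] {K₁ K₂ F : Type*} [Field K₁] [Fintype K₁] [Field K₂] [Fintype K₂]
  [Field F] [Fintype F] [Algebra K₁ F] [Algebra (ZMod p) K₁] [Algebra (ZMod p) F]

/-- When the field of the trace is a proper subfield, the fibres on the quadric of an
`𝔽_p`-linear form have size divisible by `p`. -/
theorem prime_dvd_card_zeros (hF : ringChar F ≠ 2) (hK₁ : ringChar K₁ ≠ 2) {k : ℕ}
    (hcard : Fintype.card F = Fintype.card K₁ * p * k) (hp₁ : p ∣ Fintype.card K₁)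
    {u : F × F} (hu : u ≠ 0) (c : ZMod p) :
    p ∣ ((definingSet K₁ F).filter fun v =>
      Algebra.trace (ZMod p) F (u.1 * v.1 + u.2 * v.2) + c = 0).card := by
  have : IsScalarTower (ZMod p) K₁ F :=
    IsScalarTower.of_algebraMap_eq' (Subsingleton.elim _ _)
  have hz := card_zeros hF hK₁ (traceChar_isPrimitive p F) (traceChar_isPrimitive p K₁)
    (traceChar_isPrimitive p (ZMod p)) (traceChar_trace p K₁) (traceChar_trace p (ZMod p)) hu c
  obtain ⟨T, hT⟩ : ∃ T : ℤ, zeroSum K₁ (traceChar p F) (traceChar p (ZMod p))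
      (u.1 ^ 2 + u.2 ^ 2) c = ((p * T : ℤ) : ℂ) := by
    -- Over the alphabet 𝔽_p the zero sum is (q₁-1)p, 0, q₁-p or q₁. The factor p must come from
    -- here, since `k` may be prime to p.
    rw [zeroSum_of_le (traceChar_isPrimitive p K₁) (traceChar_isPrimitive p (ZMod p))
      (traceChar_trace p K₁)]
    obtain ⟨m, hm⟩ := hp₁
    rw [ZMod.card, hm]
    split_ifs
    · exact ⟨p * m - 1, by push_cast; ring⟩
    · exact ⟨0, by simp⟩
    · exact ⟨m - 1, by push_cast; ring⟩
    · exact ⟨m, by push_cast; ring⟩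
  rw [hT, complexQuadraticChar_apply, ZMod.card, hcard] at hz
  have h1 : (Fintype.card K₁ : ℂ) * p ≠ 0 :=
    mul_ne_zero card_ne_zero_cast (Nat.cast_ne_zero.mpr (Fact.out : p.Prime).ne_zero)
  have hz' := mul_left_cancel₀ (c := ((p * (Fintype.card K₁ * k ^ 2 +
    quadraticChar F (-1) * k * T) : ℤ) : ℂ)) h1 (hz.trans (by push_cast; ring))
  rw [← Int.cast_natCast, Int.cast_inj] at hz'
  exact_mod_cast Dvd.intro _ hz'.symm

theorem sum_comp_trace_eq_zero (hF : ringChar F ≠ 2) (hK₁ : ringChar K₁ ≠ 2) {k : ℕ}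
    (hcard : Fintype.card F = Fintype.card K₁ * p * k) (hp₁ : p ∣ Fintype.card K₁)
    {u : F × F} (hu : u ≠ 0) (f : ZMod p → ZMod p) :
    ∑ v ∈ definingSet K₁ F, f (Algebra.trace (ZMod p) F (u.1 * v.1 + u.2 * v.2)) = 0 := by
  rw [← Finset.sum_fiberwise_of_maps_to
    (g := fun v : F × F => Algebra.trace (ZMod p) F (u.1 * v.1 + u.2 * v.2)) (t := Finset.univ)
    (fun _ _ => Finset.mem_univ _)]
  refine Finset.sum_eq_zero fun t _ => ?_
  rw [Finset.sum_congr rfl (g := fun _ => f t)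
    (fun x hx => by rw [(Finset.mem_filter.mp hx).2]), Finset.sum_const, nsmul_eq_mul]
  have h := prime_dvd_card_zeros hF hK₁ hcard hp₁ hu (-t)
  simp only [← sub_eq_add_neg, sub_eq_zero] at h
  rw [(ZMod.natCast_eq_zero_iff _ _).mpr h, zero_mul]

/-- Polarization of the vanishing of sums of squares, with 2 invertible. -/
theorem sum_trace_mul_trace_eq_zero (hF : ringChar F ≠ 2) (hK₁ : ringChar K₁ ≠ 2) {k : ℕ}
    (hp2 : p ≠ 2) (hcard : Fintype.card F = Fintype.card K₁ * p * k)
    (hp₁ : p ∣ Fintype.card K₁) (u u' : F × F) :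
    ∑ v ∈ definingSet K₁ F, Algebra.trace (ZMod p) F (u.1 * v.1 + u.2 * v.2) *
      Algebra.trace (ZMod p) F (u'.1 * v.1 + u'.2 * v.2) = 0 := by
  have hsq : ∀ u : F × F, ∑ v ∈ definingSet K₁ F,
      Algebra.trace (ZMod p) F (u.1 * v.1 + u.2 * v.2) ^ 2 = 0 := by
    intro u
    rcases eq_or_ne u 0 with rfl | hu
    · simp
    · exact sum_comp_trace_eq_zero hF hK₁ hcard hp₁ hu fun t => t ^ 2
  have h2 : (2 : ZMod p) ≠ 0 := Ring.two_ne_zero (by rwa [ZMod.ringChar_zmod_n])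
  have h := hsq (u + u')
  have hexp : ∀ v : F × F, Algebra.trace (ZMod p) F ((u + u').1 * v.1 + (u + u').2 * v.2) ^ 2 =
      Algebra.trace (ZMod p) F (u.1 * v.1 + u.2 * v.2) ^ 2 +
      Algebra.trace (ZMod p) F (u'.1 * v.1 + u'.2 * v.2) ^ 2 +
      2 * (Algebra.trace (ZMod p) F (u.1 * v.1 + u.2 * v.2) *
        Algebra.trace (ZMod p) F (u'.1 * v.1 + u'.2 * v.2)) := by
    intro v
    rw [show (u + u').1 * v.1 + (u + u').2 * v.2 =
      (u.1 * v.1 + u.2 * v.2) + (u'.1 * v.1 + u'.2 * v.2) by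
        simp only [Prod.fst_add, Prod.snd_add]; ring, map_add]
    ring
  simp only [hexp, Finset.sum_add_distrib, hsq, zero_add, ← Finset.mul_sum] at h
  exact (mul_eq_zero.mp h).resolve_left h2

/-- Every `𝔽_p`-linear form is a trace form. -/
theorem exists_trace_mul_eq (φ : F →ₗ[ZMod p] ZMod p) :
    ∃ d : F, ∀ z, φ z = Algebra.trace (ZMod p) F (d * z) := by
  have : Module.Finite (ZMod p) F := Module.Finite.of_finite
  have hnd := traceForm_nondegenerate (ZMod p) F
  refine ⟨((Algebra.traceForm (ZMod p) F).toDual hnd).symm φ, fun z => ?_⟩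
  rw [← Algebra.traceForm_apply, LinearMap.BilinForm.apply_toDual_symm_apply]

/-- In an 𝔽_p-basis of K₂ each coordinate of Tr_{F/K₂} is a form z ↦ Tr(d·z) to 𝔽_p. Thus the
constant, linear and quadratic parts of an inner product of codewords reduce to sums over 𝔽_p, and
the size of K₂ plays no role. -/
theorem isSelfOrthogonal_codeCD [Algebra K₂ F] [Algebra (ZMod p) K₂]
    (hF : ringChar F ≠ 2) (hK₁ : ringChar K₁ ≠ 2) {k : ℕ}
    (hp2 : p ≠ 2) (hcard : Fintype.card F = Fintype.card K₁ * p * k)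
    (hp₁ : p ∣ Fintype.card K₁) : IsSelfOrthogonal (codeCD K₁ K₂ F) := by
  have : IsScalarTower (ZMod p) K₂ F :=
    IsScalarTower.of_algebraMap_eq' (Subsingleton.elim _ _)
  have : Module.Finite (ZMod p) K₂ := Module.Finite.of_finite
  let b := Module.finBasis (ZMod p) K₂
  have hd : ∀ i, ∃ d : F, ∀ z, b.coord i (Algebra.trace K₂ F z) =
      Algebra.trace (ZMod p) F (d * z) := fun i =>
    exists_trace_mul_eq (b.coord i ∘ₗ (Algebra.trace K₂ F).restrictScalars (ZMod p))
  choose d hd using hd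
  have hrepr : ∀ (u v : F × F), Algebra.trace K₂ F (u.1 * v.1 + u.2 * v.2) =
      ∑ i, algebraMap (ZMod p) K₂ (Algebra.trace (ZMod p) F
        ((d i • u).1 * v.1 + (d i • u).2 * v.2)) * b i := by
    intro u v
    conv_lhs => rw [← b.sum_repr (Algebra.trace K₂ F (u.1 * v.1 + u.2 * v.2))]
    refine Finset.sum_congr rfl fun i _ => ?_
    rw [← b.coord_apply, hd, Algebra.smul_def]
    simp only [Prod.smul_fst, Prod.smul_snd, smul_eq_mul]
    congr 3
    ring
  have hone : ((definingSet K₁ F).card : K₂) = 0 := by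
    have h := sum_comp_trace_eq_zero (p := p) hF hK₁ hcard hp₁
      (one_ne_zero (α := F × F)) fun _ => 1
    rw [Finset.sum_const, nsmul_one] at h
    have := congrArg (algebraMap (ZMod p) K₂) h
    simpa using this
  have hlin : ∀ u : F × F, ∑ v ∈ definingSet K₁ F,
      Algebra.trace K₂ F (u.1 * v.1 + u.2 * v.2) = 0 := by
    intro u
    simp only [hrepr]
    rw [Finset.sum_comm]
    refine Finset.sum_eq_zero fun i _ => ?_
    rw [← Finset.sum_mul, ← map_sum]
    rcases eq_or_ne (d i • u) 0 with h0 | h0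
    · simp [h0]
    · rw [sum_comp_trace_eq_zero hF hK₁ hcard hp₁ h0 fun t => t, map_zero, zero_mul]
  have hquad : ∀ u u' : F × F, ∑ v ∈ definingSet K₁ F,
      Algebra.trace K₂ F (u.1 * v.1 + u.2 * v.2) *
        Algebra.trace K₂ F (u'.1 * v.1 + u'.2 * v.2) = 0 := by
    intro u u'
    simp only [hrepr, Finset.sum_mul_sum]
    rw [Finset.sum_comm]
    refine Finset.sum_eq_zero fun i _ => ?_
    rw [Finset.sum_comm]
    refine Finset.sum_eq_zero fun j _ => ?_
    simp only [mul_mul_mul_comm _ (b i), ← map_mul]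
    rw [← Finset.sum_mul, ← map_sum, sum_trace_mul_trace_eq_zero hF hK₁ hp2 hcard hp₁, map_zero,
      zero_mul]
  rintro _ ⟨a, a', c, rfl⟩ _ ⟨b, b', c', rfl⟩
  rw [dotProduct, Finset.sum_coe_sort (definingSet K₁ F) fun v : F × F =>
    (Algebra.trace K₂ F (a * v.1 + a' * v.2) + c) * (Algebra.trace K₂ F (b * v.1 + b' * v.2) + c')]
  simp only [add_mul, mul_add, Finset.sum_add_distrib, ← Finset.sum_mul, ← Finset.mul_sum,
    hlin (a, a'), hlin (b, b'), hquad (a, a') (b, b')]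
  simp [hone]

end SelfOrthogonal

/-! ### Dimension and minimum distance of the dual code. -/

section Dual

theorem finrank_dualCode_add {ι K : Type*} [Fintype ι] [Field K] (C : Submodule K (ι → K)) :
    Module.finrank K (dualCode C) + Module.finrank K C = Fintype.card ι := by
  let B : LinearMap.BilinForm K (ι → K) := dotProductBilin K K
  have hB : B.Nondegenerate := by
    constructor
    · intro v h
      exact dotProduct_eq_zero v h
    · intro v h
      exact dotProduct_eq_zero v fun w => by rw [dotProduct_comm]; exact h w
  have hdual : dualCode C = B.orthogonal C := by
    ext a
    constructor
    · intro h c hc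
      exact (dotProduct_comm c a).trans (h c hc)
    · intro h c hc
      exact (dotProduct_comm a c).trans (h c hc)
  rw [hdual, LinearMap.BilinForm.finrank_orthogonal hB, Module.finrank_fintype_fun_eq_card]
  have := Submodule.finrank_le C
  rw [Module.finrank_fintype_fun_eq_card] at this
  omega

variable {K₁ K₂ F : Type*} [Field K₁] [Field K₂] [Field F] [Fintype F]
  [Algebra K₁ F] [Algebra K₂ F]

theorem exists_ne_zero_mem_definingSet (h : Function.Injective (encode K₁ K₂ F)) :
    ∃ v ∈ definingSet K₁ F, v ≠ 0 := by
  by_contra! hv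
  have h1 : encode K₁ K₂ F ((1, 0), 0) = 0 := by
    ext v
    simp [encode_apply, hv v.1 v.2]
  have := h (h1.trans encode_zero_zero.symm)
  simp at this

theorem dualCode_dotProduct {c : definingSet K₁ F → K₂} (hc : c ∈ dualCode (codeCD K₁ K₂ F))
    (x : (F × F) × K₂) : ∑ v, c v * encode K₁ K₂ F x v = 0 :=
  hc _ (mem_codeCD_iff.mpr ⟨x, rfl⟩)

variable [Fintype K₂]

theorem eq_zero_of_trace_mul_eq_zero {z : F} (h : ∀ a, Algebra.trace K₂ F (a * z) = 0) :
    z = 0 := by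
  by_contra hz
  have : Module.Finite K₂ F := Module.Finite.of_finite
  obtain ⟨y, hy⟩ := Algebra.trace_surjective K₂ F 1
  have := h (y / z)
  rw [div_mul_cancel₀ _ hz, hy] at this
  exact one_ne_zero this

theorem three_le_hammingNorm_of_mem_dualCode {c : definingSet K₁ F → K₂}
    (hc : c ∈ dualCode (codeCD K₁ K₂ F)) (h0 : c ≠ 0) : 3 ≤ hammingNorm c := by
  have hsum : ∀ x, ∑ v with c v ≠ 0, c v * encode K₁ K₂ F x v = 0 := by
    intro x
    rw [Finset.sum_filter_of_ne, dualCode_dotProduct hc]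
    exact fun v _ h => left_ne_zero_of_mul h
  by_contra! hlt
  have hpos : 0 < hammingNorm c := hammingNorm_pos_iff.mpr h0
  rw [hammingNorm] at hlt hpos
  have hcases : (Finset.univ.filter fun v => c v ≠ 0).card = 1 ∨
      (Finset.univ.filter fun v => c v ≠ 0).card = 2 := by omega
  rcases hcases with h1 | h2
  · obtain ⟨i, hi⟩ := Finset.card_eq_one.mp h1
    have hci : c i ≠ 0 := by
      have : i ∈ Finset.univ.filter fun v => c v ≠ 0 := by rw [hi]; simp
      simpa using this
    -- Weight 1 is excluded by pairing with the all-one word.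
    have := hsum (0, 1)
    rw [hi, Finset.sum_singleton, encode_apply] at this
    simp [hci] at this
  · obtain ⟨i, j, hij, h⟩ := Finset.card_eq_two.mp h2
    have hci : c i ≠ 0 := by
      have : i ∈ Finset.univ.filter fun v => c v ≠ 0 := by rw [h]; simp
      simpa using this
    have key : ∀ u : F × F,
        Algebra.trace K₂ F (u.1 * (i.1.1 - j.1.1) + u.2 * (i.1.2 - j.1.2)) = 0 := by
      intro u
      -- An affine function vanishing at `j` isolates the coordinate `i`.
      have := hsum (u, -Algebra.trace K₂ F (u.1 * j.1.1 + u.2 * j.1.2))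
      rw [h, Finset.sum_pair hij, encode_apply, encode_apply, add_neg_cancel, mul_zero, add_zero,
        ← sub_eq_add_neg, ← map_sub] at this
      rw [← (mul_eq_zero.mp this).resolve_left hci]
      congr 1
      ring
    apply hij
    refine Subtype.ext (Prod.ext ?_ ?_)
    · refine sub_eq_zero.mp (eq_zero_of_trace_mul_eq_zero (K₂ := K₂) fun a => ?_)
      simpa using key (a, 0)
    · refine sub_eq_zero.mp (eq_zero_of_trace_mul_eq_zero (K₂ := K₂) fun a => ?_)
      simpa using key (0, a)

theorem isMinDist_dualCode (hK₂ : ringChar K₂ ≠ 2) (h : Function.Injective (encode K₁ K₂ F)) :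
    IsMinDist (dualCode (codeCD K₁ K₂ F)) 3 := by
  refine ⟨?_, ?_⟩
  · obtain ⟨v, hv, hv0⟩ := exists_ne_zero_mem_definingSet h
    have h2 : (2 : K₂) ≠ 0 := Ring.two_ne_zero hK₂
    have h2F : (2 : F) ≠ 0 := by
      have := (map_ne_zero (algebraMap K₂ F)).mpr h2
      rwa [map_ofNat] at this
    have hneg : -v ∈ definingSet K₁ F := by
      rw [mem_definingSet] at hv ⊢
      simpa using hv
    have hvn : v ≠ -v := by
      intro h
      apply hv0
      refine Prod.ext ?_ ?_
      · have := congrArg Prod.fst h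
        have h3 : 2 * v.1 = 0 := by
          rw [Prod.fst_neg] at this
          linear_combination this
        exact (mul_eq_zero.mp h3).resolve_left h2F
      · have := congrArg Prod.snd h
        have h3 : 2 * v.2 = 0 := by
          rw [Prod.snd_neg] at this
          linear_combination this
        exact (mul_eq_zero.mp h3).resolve_left h2F
    let a : definingSet K₁ F := ⟨v, hv⟩
    let b : definingSet K₁ F := ⟨-v, hneg⟩
    let z : definingSet K₁ F := ⟨0, zero_mem_definingSet⟩
    have hab : a ≠ b := fun h => hvn (congrArg Subtype.val h)
    have haz : a ≠ z := fun h => hv0 (congrArg Subtype.val h)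
    have hbz : b ≠ z := fun h => hv0 (neg_eq_zero.mp (congrArg Subtype.val h))
    -- Every affine function satisfies f(v) + f(-v) - 2f(0) = 0; odd characteristic keeps the points
    -- distinct and -2 nonzero.
    let c : definingSet K₁ F → K₂ := Pi.single a 1 + Pi.single b 1 + Pi.single z (-2)
    have hsupp : (Finset.univ.filter fun w => c w ≠ 0) = {a, b, z} := by
      ext w
      simp only [Finset.mem_filter, Finset.mem_univ, true_and, Finset.mem_insert,
        Finset.mem_singleton]
      constructor
      · contrapose!
        rintro ⟨h1, h2, h3⟩
        simp [c, h1, h2, h3]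
      · rintro (rfl | rfl | rfl)
        · simp [c, hab, haz]
        · simp [c, hab.symm, hbz]
        · simp [c, haz.symm, hbz.symm, h2]
    have hnorm : hammingNorm c = 3 := by
      rw [hammingNorm, hsupp, Finset.card_eq_three]
      exact ⟨a, b, z, hab, haz, hbz, rfl⟩
    refine ⟨c, ?_, ?_, hnorm⟩
    · intro f hf
      obtain ⟨x, rfl⟩ := mem_codeCD_iff.mp hf
      simp only [c, add_dotProduct, single_dotProduct, encode_apply, a, b, z]
      simp only [Prod.fst_neg, Prod.snd_neg, Prod.fst_zero, Prod.snd_zero, mul_neg, mul_zero,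
        add_zero, map_zero, map_add, map_neg]
      ring
    · intro hc
      rw [hc, hammingNorm_zero] at hnorm
      omega
  · rintro w ⟨c, hc, h0, rfl⟩
    exact three_le_hammingNorm_of_mem_dualCode hc h0

end Dual

/-! ### Characteristic and degree read off from cardinalities, then the main theorem. -/

section Cardinalities

theorem ringChar_ne_two_of_card {K : Type*} [Field K] [Fintype K] {p t : ℕ} (hp : Odd p)
    (h : Fintype.card K = p ^ t) : ringChar K ≠ 2 := by
  intro h2
  have := FiniteField.even_card_of_char_two h2
  have hodd := Nat.odd_iff.mp (hp.pow (n := t))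
  omega

theorem finrank_eq_of_card {K F : Type*} [Field K] [Fintype K] [Field F] [Fintype F]
    [Algebra K F] {p s t : ℕ} (hp : p.Prime) (ht : 0 < t) (hK : Fintype.card K = p ^ t)
    (hF : Fintype.card F = p ^ s) : Module.finrank K F = s / t := by
  have h := Module.card_eq_pow_finrank (K := K) (V := F)
  rw [hK, hF, ← pow_mul] at h
  rw [Nat.pow_right_injective hp.two_le h, Nat.mul_div_cancel_left _ ht]

end Cardinalities

theorem theorem4p1
    (p s s₁ s₂ : ℕ) (hp : p.Prime) (hp2 : Odd p) (hs : 0 < s) (hs₁ : s₁ ∣ s) (hs₂ : s₂ ∣ s)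
    (K₁ K₂ F : Type*) [Field K₁] [Fintype K₁] [Field K₂] [Fintype K₂] [Field F] [Fintype F]
    [Algebra K₁ F] [Algebra K₂ F]
    (hF : Fintype.card F = p ^ s) (hK₁ : Fintype.card K₁ = p ^ s₁)
    (hK₂ : Fintype.card K₂ = p ^ s₂)
    -- the degenerate case in which the defining set is `{(0, 0)}` is excluded
    (hD : ¬ (s₁ = s ∧ p ^ s % 4 = 3)) :
    -- (i)
    (s₂ ∣ s₁ →
      ((definingSet K₁ F).card : ℂ) = quadricCount p s s₁ ∧
      Module.finrank K₂ (codeCD K₁ K₂ F) = 2 * s / s₂ + 1 ∧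
      HasWeightDistribution (codeCD K₁ K₂ F) (weightTable₁ p s s₁ s₂) ∧
      (2 * s₁ ≤ s → IsSelfOrthogonal (codeCD K₁ K₂ F))) ∧
    -- (ii)
    (s₁ ∣ s₂ → Odd (s₂ / s₁) →
      ((definingSet K₁ F).card : ℂ) = quadricCount p s s₁ ∧
      Module.finrank K₂ (codeCD K₁ K₂ F) = 2 * s / s₂ + 1 ∧
      HasWeightDistribution (codeCD K₁ K₂ F)
        (weightTable₂ p s s₁ s₂ (etaNegOne K₁) (etaNegOne K₂)) ∧
      (s₁ + s₂ < 2 * s → IsSelfOrthogonal (codeCD K₁ K₂ F))) ∧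
    -- (iii)
    (s₁ ∣ s₂ → Even (s₂ / s₁) →
      ((definingSet K₁ F).card : ℂ) = quadricCount p s s₁ ∧
      Module.finrank K₂ (codeCD K₁ K₂ F) = 2 * s / s₂ + 1 ∧
      HasWeightDistribution (codeCD K₁ K₂ F)
        (weightTable₃ p s s₁ s₂ (etaNegOne K₂)) ∧
      (2 * s₁ + s₂ < 2 * s → IsSelfOrthogonal (codeCD K₁ K₂ F))) ∧
    -- (iv)
    (((definingSet K₁ F).card : ℂ) = quadricCount p s s₁ ∧
      (Module.finrank K₂ (dualCode (codeCD K₁ K₂ F)) : ℂ)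
        = quadricCount p s s₁ - ((2 * s / s₂ + 1 : ℕ) : ℂ) ∧
      IsMinDist (dualCode (codeCD K₁ K₂ F)) 3 ∧
      (s = s₂ → IsAMDS (dualCode (codeCD K₁ K₂ F)))) := by
  have : Fact p.Prime := ⟨hp⟩
  have : CharP F p := charP_of_card_eq_prime_pow hF
  have : CharP K₁ p := charP_of_card_eq_prime_pow hK₁
  have : CharP K₂ p := charP_of_card_eq_prime_pow hK₂
  let : Algebra (ZMod p) F := ZMod.algebra F p
  let : Algebra (ZMod p) K₁ := ZMod.algebra K₁ p
  let : Algebra (ZMod p) K₂ := ZMod.algebra K₂ p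
  have hs₁0 : 0 < s₁ := Nat.pos_of_dvd_of_pos hs₁ hs
  have hs₂0 : 0 < s₂ := Nat.pos_of_dvd_of_pos hs₂ hs
  have hs₁le : s₁ ≤ s := Nat.le_of_dvd hs hs₁
  have hs₂le : s₂ ≤ s := Nat.le_of_dvd hs hs₂
  have hcF := ringChar_ne_two_of_card hp2 hF
  have hc₁ := ringChar_ne_two_of_card hp2 hK₁
  have hc₂ := ringChar_ne_two_of_card hp2 hK₂
  have hψ := traceChar_isPrimitive p F
  have hψ₁ := traceChar_isPrimitive p K₁
  have hψ₂ := traceChar_isPrimitive p K₂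
  have h₁ := traceChar_trace p K₁ (F := F)
  have h₂ := traceChar_trace p K₂ (F := F)
  have hG := gaussValue_sq hp2 hcF hF
  have hqF : (p : ℂ) ^ s = Fintype.card F := by rw [hF]; push_cast; rfl
  have hq₁ : (p : ℂ) ^ s₁ = Fintype.card K₁ := by rw [hK₁]; push_cast; rfl
  have hq₂ : (p : ℂ) ^ s₂ = Fintype.card K₂ := by rw [hK₂]; push_cast; rfl
  have hinj : Function.Injective (encode K₁ K₂ F) := by
    refine encode_injective hcF hc₁ hψ hψ₁ hψ₂ h₁ h₂ fun h => hD ⟨?_, ?_⟩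
    · exact Nat.pow_right_injective hp.two_le (hK₁.symm.trans (h.1.trans hF))
    · have h' : quadraticChar F (-1) = -1 := by
        have := h.2
        rw [complexQuadraticChar_apply] at this
        exact_mod_cast this
      rw [quadraticChar_neg_one_iff_not_isSquare, FiniteField.isSquare_neg_one_iff, not_not,
        hF] at h'
      exact h'
  have hn := card_definingSet hcF hψ hψ₁ h₁
  have hcount : ((definingSet K₁ F).card : ℂ) = quadricCount p s s₁ := by
    rw [hn, quadricCount, hG, hq₁, mul_comm 2 s, pow_mul, hqF]
  have hdim : Module.finrank K₂ (codeCD K₁ K₂ F) = 2 * s / s₂ + 1 := by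
    rw [finrank_codeCD hinj, finrank_eq_of_card hp hs₂0 hK₂ hF, Nat.mul_div_assoc _ hs₂]
  have hdual := finrank_dualCode_add (codeCD K₁ K₂ F)
  rw [Fintype.card_coe, hdim] at hdual
  have hmin := isMinDist_dualCode hc₂ hinj
  -- Each of the three numerical conditions for self-orthogonality implies s₁ < s.
  have hself : s₁ < s → IsSelfOrthogonal (codeCD K₁ K₂ F) := by
    intro hlt
    have hp2' : p ≠ 2 := by rintro rfl; exact absurd hp2 (by decide)
    refine isSelfOrthogonal_codeCD (p := p) (k := p ^ (s - s₁ - 1)) hcF hc₁ hp2' ?_ ?_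
    · rw [hF, hK₁, ← pow_succ, ← pow_add]
      congr 1
      omega
    · rw [hK₁]
      exact dvd_pow_self p hs₁0.ne'
  have hweight := fun w (g : ℂ → ℂ) => weightCount_eq_sum_zeroSum hcF hc₁ hψ hψ₁ hψ₂ h₁ h₂ hinj w
    (g := g)
  have hη₁ : etaNegOne K₁ = complexQuadraticChar K₁ (-1) := rfl
  have hη₂ : etaNegOne K₂ = complexQuadraticChar K₂ (-1) := rfl
  refine ⟨fun hdvd => ⟨hcount, hdim, ?_, fun h => hself (by omega)⟩,
    fun hdvd hodd => ⟨hcount, hdim, ?_, fun h => hself ?_⟩,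
    fun hdvd heven => ⟨hcount, hdim, ?_, fun h => hself (by omega)⟩, hcount, ?_, hmin, ?_⟩
  · obtain ⟨r, rfl⟩ := hdvd
    obtain ⟨f, hf⟩ := exists_ringHom_of_card (K₁ := K₂) (K₂ := K₁) (F := F) (r := r)
      (by rw [hK₁, hK₂, ← pow_mul])
    let := f.toAlgebra
    have : IsScalarTower K₂ K₁ F := IsScalarTower.of_algebraMap_eq fun x => (hf x).symm
    intro w
    obtain ⟨g, hg⟩ : ∃ g : ℂ → ℂ, g = fun z => if z = (w : ℂ) then (1 : ℂ) else 0 := ⟨_, rfl⟩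
    rw [hweight w g hg]
    refine (congrArg (_ + ·) (sum_zeroSum_of_le hcF hψ hψ₁ hψ₂ h₁
      (fun T => g ((definingSet K₁ F).card -
        ((Fintype.card F : ℂ) ^ 2 + complexQuadraticChar F (-1) * Fintype.card F * T) /
          (Fintype.card K₁ * Fintype.card K₂))))).trans ?_
    rw [sum_weightTable₁ hg hqF hq₁ hq₂ card_ne_zero_cast card_ne_zero_cast hG, hn]
  · rw [hη₁, hη₂]
    obtain ⟨r, rfl⟩ := hdvd
    rw [Nat.mul_div_cancel_left _ hs₁0] at hodd
    have hcard : Fintype.card K₂ = Fintype.card K₁ ^ r := by rw [hK₁, hK₂, ← pow_mul]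
    obtain ⟨f, hf⟩ := exists_ringHom_of_card (K₁ := K₁) (K₂ := K₂) (F := F) hcard
    let := f.toAlgebra
    have : IsScalarTower K₁ K₂ F := IsScalarTower.of_algebraMap_eq fun x => (hf x).symm
    have h₁₂ := traceChar_trace p K₁ (F := K₂)
    have hχ : complexQuadraticChar K₂ (-1) = complexQuadraticChar K₁ (-1) ^ r := by
      have := quadraticChar_algebraMap hc₁ hcard (neg_ne_zero.mpr (one_ne_zero (α := K₁)))
      rw [map_neg, map_one] at this
      rw [complexQuadraticChar_apply, complexQuadraticChar_apply, this, Int.cast_pow]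
    have hχ₁ := complexQuadraticChar_eq_or (neg_ne_zero.mpr (one_ne_zero (α := K₁)))
    have hχ₂ : complexQuadraticChar K₂ (-1) = complexQuadraticChar K₁ (-1) := by
      rw [hχ]
      rcases hχ₁ with h | h <;> rw [h]
      · exact one_pow r
      · exact hodd.neg_one_pow
    have hγ : complexQuadraticChar K₁ (-1) * quadraticGaussSum (traceChar p K₁) *
        quadraticGaussSum (traceChar p K₂) =
          complexQuadraticChar K₁ (-1) * gaussValue p s₁ * gaussValue p (s₁ * r) ∨
        complexQuadraticChar K₁ (-1) * quadraticGaussSum (traceChar p K₁) *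
        quadraticGaussSum (traceChar p K₂) =
          -(complexQuadraticChar K₁ (-1) * gaussValue p s₁ * gaussValue p (s₁ * r)) := by
      -- Equality of squares gives equality up to sign, which is all the table needs.
      rw [← sq_eq_sq_iff_eq_or_eq_neg]
      simp only [mul_pow, quadraticGaussSum_sq hc₁ hψ₁, quadraticGaussSum_sq hc₂ hψ₂,
        gaussValue_sq hp2 hc₁ hK₁, gaussValue_sq hp2 hc₂ hK₂]
    intro w
    obtain ⟨g, hg⟩ : ∃ g : ℂ → ℂ, g = fun z => if z = (w : ℂ) then (1 : ℂ) else 0 := ⟨_, rfl⟩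
    rw [hweight w g hg]
    refine (congrArg (_ + ·) (sum_zeroSum_of_odd hcF hc₁ hc₂ hψ hψ₁ hψ₂ h₂ h₁₂ hodd hcard
      (fun T => g ((definingSet K₁ F).card -
        ((Fintype.card F : ℂ) ^ 2 + complexQuadraticChar F (-1) * Fintype.card F * T) /
          (Fintype.card K₁ * Fintype.card K₂))) rfl)).trans ?_
    rw [sum_weightTable₂ hg hqF hq₁ hq₂ card_ne_zero_cast card_ne_zero_cast hG hχ₂ hγ, hn]
  · have := Nat.le_of_dvd hs₂0 hdvd
    omega
  · rw [hη₂]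
    obtain ⟨r, rfl⟩ := hdvd
    rw [Nat.mul_div_cancel_left _ hs₁0] at heven
    have hcard : Fintype.card K₂ = Fintype.card K₁ ^ r := by rw [hK₁, hK₂, ← pow_mul]
    obtain ⟨f, hf⟩ := exists_ringHom_of_card (K₁ := K₁) (K₂ := K₂) (F := F) hcard
    let := f.toAlgebra
    have : IsScalarTower K₁ K₂ F := IsScalarTower.of_algebraMap_eq fun x => (hf x).symm
    have h₁₂ := traceChar_trace p K₁ (F := K₂)
    have hχ : complexQuadraticChar K₂ (-1) = complexQuadraticChar K₁ (-1) ^ r := by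
      have := quadraticChar_algebraMap hc₁ hcard (neg_ne_zero.mpr (one_ne_zero (α := K₁)))
      rw [map_neg, map_one] at this
      rw [complexQuadraticChar_apply, complexQuadraticChar_apply, this, Int.cast_pow]
    have hχ₁ := complexQuadraticChar_eq_or (neg_ne_zero.mpr (one_ne_zero (α := K₁)))
    have hχ₂ : complexQuadraticChar K₂ (-1) = 1 := by
      rw [hχ]
      rcases hχ₁ with h | h <;> rw [h]
      · exact one_pow r
      · exact heven.neg_one_pow
    have hγ : quadraticGaussSum (traceChar p K₂) = gaussValue p (s₁ * r) ∨
        quadraticGaussSum (traceChar p K₂) = -gaussValue p (s₁ * r) := by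
      rw [← sq_eq_sq_iff_eq_or_eq_neg, quadraticGaussSum_sq hc₂ hψ₂, gaussValue_sq hp2 hc₂ hK₂]
    rw [hχ₂]
    intro w
    obtain ⟨g, hg⟩ : ∃ g : ℂ → ℂ, g = fun z => if z = (w : ℂ) then (1 : ℂ) else 0 := ⟨_, rfl⟩
    rw [hweight w g hg]
    refine (congrArg (_ + ·) (sum_zeroSum_of_even hcF hc₁ hc₂ hψ hψ₁ hψ₂ h₂ h₁₂ heven hcard
      (fun T => g ((definingSet K₁ F).card -
        ((Fintype.card F : ℂ) ^ 2 + complexQuadraticChar F (-1) * Fintype.card F * T) /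
          (Fintype.card K₁ * Fintype.card K₂))) rfl)).trans ?_
    rw [sum_weightTable₃ hg hqF hq₁ hq₂ card_ne_zero_cast card_ne_zero_cast hG hγ, hn]
  · rw [← hcount, ← hdual]
    push_cast
    ring
  · rintro rfl
    -- For s = s₂ the code has dimension 3, which equals the dual distance.
    refine ⟨3, hmin, ?_⟩
    rw [Fintype.card_coe, ← hdual, Nat.mul_div_cancel _ hs]
    ring
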